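/- Let $s>0$, let $J_\nu$ denote the Bessel function of the first kind, and for $x,y>0$ put $$\mathbb K^{Bessel}_{2,\nu}(x,y)=\frac{\sqrt{x}\,J_{\nu+1}(\sqrt{x})J_\nu(\sqrt{y})-\sqrt{y}\,J_{\nu+1}(\sqrt{y})J_\nu(\sqrt{x})}{2(x-y)},$$ extended by continuity to $x=y$, $$K^{Bessel}_s(x,y)=2\sqrt{\frac{x}{y}}\;\mathbb K^{Bessel}_{2,2s-1}(4x,4y)-\frac{J_{2s-1}(2\sqrt{y})}{2\sqrt{y}}\int_0^{\sqrt{x}}J_{2s-1}(2t)\,dt,$$ $$\mathbb K^{Bessel}_{4,s}(x,y)=\begin{bmatrix}K^{Bessel}_s(x,y)&\int_y^xK^{Bessel}_s(x,t)\,dt\\ \frac{\partial}{\partial x}K^{Bessel}_s(x,y)&K^{Bessel}_s(y,x)\end{bmatrix}.$$ Then $$\int_0^\infty\left(\int_0^\infty\det\mathbb K^{Bessel}_{4,s}(x,y)\,dy-K^{Bessel}_s(x,x)\right)dx=0,$$ where both integrals are improper integrals $\lim_{R\to\infty}\int_0^R$ of functions integrable on every $(0,R]$: the inner one converges for every $x>0$,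 and the outer one converges to $0$. -/

import Mathlib

open Filter Topology MeasureTheory

noncomputable section

/-- The Bessel function of the first kind `J_ν(z)`, for real order `ν` and real `z > 0`:
`J_ν(z) = (z/2)^ν ∑_{k ≥ 0} (-1)^k (z/2)^(2k) / (k! Γ(ν+k+1))`. -/
def besselJ (ν z : ℝ) : ℝ :=
  (z / 2) ^ ν *
    ∑' k : ℕ, (-1 : ℝ) ^ k * (z / 2) ^ (2 * k) / ((k.factorial : ℝ) * Real.Gamma (ν + k + 1))

/-- The quotient defining the determinantal Bessel kernel off the diagonal. -/
def besselQuotient (ν x y : ℝ) : ℝ :=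
  (√x * besselJ (ν + 1) √x * besselJ ν √y - √y * besselJ (ν + 1) √y * besselJ ν √x) /
    (2 * (x - y))

/-- The determinantal Bessel kernel of order `ν` on `(0, ∞)²`: the quotient above for `x ≠ y`,
extended by continuity to the diagonal. -/
def besselKernel (ν x y : ℝ) : ℝ :=
  if x = y then limUnder (𝓝[≠] x) (fun u => besselQuotient ν u x) else besselQuotient ν x y

/-- The scalar kernel from which the symplectic Bessel kernel is built, for `x, y > 0`. -/
def symplecticBesselScalar (s x y : ℝ) : ℝ :=
  2 * √(x / y) * besselKernel (2 * s - 1) (4 * x) (4 * y) -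
    besselJ (2 * s - 1) (2 * √y) / (2 * √y) * ∫ t in (0 : ℝ)..√x, besselJ (2 * s - 1) (2 * t)

/-- The `2 × 2` matrix-valued symplectic Bessel kernel, for `x, y > 0`. -/
def symplecticBesselKernel (s x y : ℝ) : Matrix (Fin 2) (Fin 2) ℝ :=
  !![symplecticBesselScalar s x y, ∫ t in y..x, symplecticBesselScalar s x t;
     deriv (fun u => symplecticBesselScalar s u y) x, symplecticBesselScalar s y x]

/-- `∫_0^∞ f(x) dx` converges, as an improper integral at `∞`, to `L`: `f` is integrable on
`(0, R]` for every `R > 0`, and `∫_0^R f(x) dx → L` as `R → ∞`. -/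
def HasImproperIntegral (f : ℝ → ℝ) (L : ℝ) : Prop :=
  (∀ R : ℝ, 0 < R → IntegrableOn f (Set.Ioc 0 R) volume) ∧
    Tendsto (fun R : ℝ => ∫ x in (0 : ℝ)..R, f x) atTop (𝓝 L)

end

/-!
Everything is expressed through one function, the edge density
`h(y) = J_{2s-1}(2√y) / (2√y)` (`besselH`), together with its primitive `φ` (`besselPhi`), which
tends to `1/2` at infinity, and `w = (y h)'` (`besselW`). The scalar kernel has two expressions,
`K(x, y) = 2x ∫_0^1 t h(xt) h(yt) dt - φ(x) h(y) = φ(x) h(y) - 2 ∫_0^1 w(yt) φ(xt) dt`,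
exchanged by an integration by parts (`symplecticBesselScalar_eq`,
`symplecticBesselScalar_eq_sub`). With `P(x, y) = ∫_y^x K(x, t) dt`, the second one shows that
`∂_x K(x, y)` is antisymmetric, so that
`det = K(x, y) K(y, x) + P(x, y) ∂_y K(y, x) = 2 K(x, y) K(y, x) + ∂_y (P(x, y) K(y, x))`.
The inner integral turns out to be exactly `K(x, x)` (`hasImproperIntegral_det`), so the outer
integrand vanishes identically.

The boundary term of the exact derivative vanishes at `y = 0` and tends to `φ(x) h(x) / 4` at
infinity. Inserting the two expressions of `K` into `∫_0^R K(x, y) K(y, x) dy` and exchanging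
integrals reduces it to the pairings `∫_0^R φ(ry) h(y) dy` of two scales (`scalePairing`). As
`R → ∞` they tend to `0`, `1/8` or `1/4` according as `r < 1`, `r = 1` or `r > 1`, and they are
bounded uniformly in `R` and `r` (`exists_abs_scalePairing_le_const`), so dominated convergence
gives the limit `K(x, x) / 2 - φ(x) h(x) / 8`.

The behaviour of the pairings follows from Lommel's integral (`sub_mul_integral_besselH_mul`),
which makes the derivative in `r` explicit up to a factor `1 - r`, and from two facts about Bessel
functions of real order: the decay `J_ν(z) = O(z^{-1/2})`, from an energy estimate for the
first-order system of `J_{2s-1}` and `J_{2s}` (`exists_bessel_decay`), and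
`∫_0^∞ J_{2s-1}(t) dt = 1` (`tendsto_besselPhi`).
-/

open Filter Topology MeasureTheory

noncomputable section

/-! ### The entire function behind the Bessel function -/

/-- The entire function `∑ (-1)^k y^k / (k! Γ(μ+k))`, normalised so that
`J_ν(2√y) = (√y)^ν * besselClifford (ν + 1) y`. -/
def besselClifford (μ y : ℝ) : ℝ :=
  ∑' k : ℕ, (-1 : ℝ) ^ k * y ^ k / ((k.factorial : ℝ) * Real.Gamma (μ + k))

lemma min_one_mul_Gamma_le {μ : ℝ} (hμ : 0 < μ) (k : ℕ) :
    min 1 μ * Real.Gamma μ ≤ Real.Gamma (μ + k) := by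
  have hΓ : 0 < Real.Gamma μ := Real.Gamma_pos_of_pos hμ
  have key : ∀ k : ℕ, μ * Real.Gamma μ ≤ Real.Gamma (μ + (k + 1 : ℕ)) := by
    intro k
    induction k with
    | zero => simp [Real.Gamma_add_one hμ.ne']
    | succ k ih =>
      have h1 : Real.Gamma (μ + (k + 1 + 1 : ℕ))
          = (μ + (k + 1 : ℕ)) * Real.Gamma (μ + (k + 1 : ℕ)) := by
        rw [← Real.Gamma_add_one (by positivity)]; push_cast; ring_nf
      have h2 : 0 < Real.Gamma (μ + (k + 1 : ℕ)) := Real.Gamma_pos_of_pos (by positivity)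
      have h3 : (1 : ℝ) ≤ μ + (k + 1 : ℕ) := by
        push_cast; have : (0 : ℝ) ≤ k := k.cast_nonneg
        linarith
      rw [h1]; nlinarith
  cases k with
  | zero => simpa using mul_le_mul_of_nonneg_right (min_le_left 1 μ) hΓ.le
  | succ k => exact (mul_le_mul_of_nonneg_right (min_le_right 1 μ) hΓ.le).trans (key k)

lemma abs_besselClifford_term_le {μ : ℝ} (hμ : 0 < μ) (k : ℕ) (c : ℝ) :
    |c / ((k.factorial : ℝ) * Real.Gamma (μ + k))|
      ≤ (min 1 μ * Real.Gamma μ)⁻¹ * (|c| / k.factorial) := by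
  have h0 : 0 < min 1 μ * Real.Gamma μ :=
    mul_pos (lt_min one_pos hμ) (Real.Gamma_pos_of_pos hμ)
  have h1 := min_one_mul_Gamma_le hμ k
  have h2 : 0 < Real.Gamma (μ + k) := h0.trans_le h1
  have h3 : (0 : ℝ) < k.factorial := by positivity
  rw [abs_div, abs_of_pos (mul_pos h3 h2), ← div_div, div_eq_inv_mul _ (Real.Gamma _)]
  gcongr

lemma summable_besselClifford {μ : ℝ} (hμ : 0 < μ) (y : ℝ) :
    Summable fun k : ℕ => (-1 : ℝ) ^ k * y ^ k / ((k.factorial : ℝ) * Real.Gamma (μ + k)) := by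
  refine Summable.of_norm_bounded (g := fun k : ℕ => (min 1 μ * Real.Gamma μ)⁻¹ *
    (|y| ^ k / k.factorial)) ((Real.summable_pow_div_factorial |y|).mul_left _) fun k => ?_
  refine (abs_besselClifford_term_le hμ k _).trans_eq ?_
  simp [abs_mul, abs_pow]

lemma hasDerivAt_besselClifford {μ : ℝ} (hμ : 0 < μ) (y : ℝ) :
    HasDerivAt (besselClifford μ) (-besselClifford (μ + 1) y) y := by
  set ρ : ℝ := |y| + 1
  have hu : Summable fun k : ℕ =>
      (min 1 μ * Real.Gamma μ)⁻¹ * (k * ρ ^ (k - 1) / k.factorial) := by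
    refine Summable.mul_left _ ((summable_nat_add_iff 1).1 ?_)
    refine (Real.summable_pow_div_factorial ρ).congr fun k => ?_
    rw [Nat.factorial_succ]; push_cast
    field_simp
  have hmem : ∀ z, z ∈ Metric.ball (0 : ℝ) ρ ↔ |z| < ρ := by simp
  have key := hasDerivAt_tsum_of_isPreconnected (t := Metric.ball (0 : ℝ) ρ) (y₀ := y) (y := y)
    (g := fun (k : ℕ) z => (-1 : ℝ) ^ k * z ^ k / ((k.factorial : ℝ) * Real.Gamma (μ + k)))
    (g' := fun (k : ℕ) z => (-1 : ℝ) ^ k * (k * z ^ (k - 1)) /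
      ((k.factorial : ℝ) * Real.Gamma (μ + k)))
    hu Metric.isOpen_ball (convex_ball 0 ρ).isPreconnected ?_ ?_ ?_
    (summable_besselClifford hμ y) ?_
  · refine key.congr_deriv ?_
    have hs : Summable fun k : ℕ => (-1 : ℝ) ^ k * (k * y ^ (k - 1)) /
        ((k.factorial : ℝ) * Real.Gamma (μ + k)) := by
      refine Summable.of_norm_bounded hu fun k => ?_
      refine (abs_besselClifford_term_le hμ k _).trans ?_
      have h0 : 0 < min 1 μ * Real.Gamma μ :=
        mul_pos (lt_min one_pos hμ) (Real.Gamma_pos_of_pos hμ)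
      simp only [abs_mul, abs_pow, abs_neg, abs_one, one_pow, one_mul, Nat.abs_cast]
      gcongr
      simp [ρ]
    rw [hs.tsum_eq_zero_add, besselClifford, ← tsum_neg]
    simp only [Nat.cast_zero, zero_mul, mul_zero, zero_div, zero_add]
    congr 1; ext k
    rw [Nat.factorial_succ]; push_cast
    have : Real.Gamma (μ + 1 + k) ≠ 0 := (Real.Gamma_pos_of_pos (by positivity)).ne'
    rw [show μ + (k + 1 : ℝ) = μ + 1 + k by ring]
    have hk : (k.factorial : ℝ) ≠ 0 := by positivity
    field_simp
    simp [pow_succ, mul_comm]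
  · intro k z _
    exact ((hasDerivAt_pow k z).const_mul _).div_const _
  · intro k z hz
    refine (abs_besselClifford_term_le hμ k _).trans ?_
    have h0 : 0 < min 1 μ * Real.Gamma μ :=
      mul_pos (lt_min one_pos hμ) (Real.Gamma_pos_of_pos hμ)
    simp only [abs_mul, abs_pow, abs_neg, abs_one, one_pow, one_mul, Nat.abs_cast]
    gcongr
    exact ((hmem z).1 hz).le
  · rw [hmem]; simp [ρ]
  · rw [hmem]; simp [ρ]

lemma continuous_besselClifford {μ : ℝ} (hμ : 0 < μ) : Continuous (besselClifford μ) :=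
  continuous_iff_continuousAt.2 fun y => (hasDerivAt_besselClifford hμ y).continuousAt

/-- The contiguous relation, equivalent to `J_{μ-1} + J_{μ+1} = (2μ/z) J_μ`. -/
lemma besselClifford_contiguous {μ : ℝ} (hμ : 0 < μ) (y : ℝ) :
    y * besselClifford (μ + 2) y = μ * besselClifford (μ + 1) y - besselClifford μ y := by
  have h2 := (summable_besselClifford (by positivity : 0 < μ + 2) y).mul_left y
  have h1 := (summable_besselClifford (by positivity : 0 < μ + 1) y).mul_left μ
  have h0 := summable_besselClifford hμ y
  have hΓ : ∀ k : ℕ, Real.Gamma (μ + 1 + k) = (μ + k) * Real.Gamma (μ + k) := fun k => by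
    rw [← Real.Gamma_add_one (by positivity)]; ring_nf
  have hp : ∀ k : ℕ, 0 < Real.Gamma (μ + k) := fun k => Real.Gamma_pos_of_pos (by positivity)
  rw [besselClifford, besselClifford, besselClifford, ← tsum_mul_left, ← tsum_mul_left,
    ← h1.tsum_sub h0, (h1.sub h0).tsum_eq_zero_add]
  have hz : μ * ((-1 : ℝ) ^ 0 * y ^ 0 / (((0 : ℕ).factorial : ℝ) * Real.Gamma (μ + 1 + (0 : ℕ))))
      - (-1 : ℝ) ^ 0 * y ^ 0 / (((0 : ℕ).factorial : ℝ) * Real.Gamma (μ + (0 : ℕ))) = 0 := by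
    rw [hΓ 0]
    have := (hp 0).ne'
    simp only [Nat.cast_zero, add_zero] at this ⊢
    field_simp
    simp
  rw [hz, zero_add]
  congr 1; ext k
  have e1 : Real.Gamma (μ + 1 + (k + 1 : ℕ)) = (μ + (k + 1 : ℕ)) * Real.Gamma (μ + (k + 1 : ℕ)) :=
    hΓ (k + 1)
  have e2 : Real.Gamma (μ + 2 + k) = Real.Gamma (μ + 1 + (k + 1 : ℕ)) := by
    push_cast; ring_nf
  have e3 := (hp (k + 1)).ne'
  rw [e2, e1, Nat.factorial_succ]
  have hk : (k.factorial : ℝ) ≠ 0 := by positivity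
  have hk1 : μ + (k + 1 : ℕ) ≠ 0 := by positivity
  set G := Real.Gamma (μ + (k + 1 : ℕ))
  push_cast at hk1 ⊢
  field_simp
  ring

/-! ### The edge density, its companion and their first-order system -/

/-- `J_{2s-1}(2√y) / (2√y)`, written as a power of `y` times an entire function. -/
def besselH (s y : ℝ) : ℝ := y ^ (s - 1) / 2 * besselClifford (2 * s) y

/-- `J_{2s}(2√y) / 2`. -/
def besselE (s y : ℝ) : ℝ := y ^ s / 2 * besselClifford (2 * s + 1) y

/-- The derivative of `y * besselH s y`. -/
def besselW (s y : ℝ) : ℝ := s * besselH s y - besselE s y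

/-- The primitive `∫_0^x J_{2s-1}(2√t) / (2√t) dt = ∫_0^{√x} J_{2s-1}(2t) dt`. -/
def besselPhi (s x : ℝ) : ℝ := ∫ t in (0 : ℝ)..x, besselH s t

variable {s : ℝ}

lemma hasDerivAt_besselH (hs : 0 < s) {y : ℝ} (hy : 0 < y) :
    HasDerivAt (besselH s) (((s - 1) * besselH s y - besselE s y) / y) y := by
  have h1 := ((Real.hasDerivAt_rpow_const (p := s - 1) (Or.inl hy.ne')).div_const 2).mul
    (hasDerivAt_besselClifford (by positivity : 0 < 2 * s) y)
  refine h1.congr_deriv ?_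
  have e1 : y ^ (s - 1 - 1) = y ^ (s - 1) / y := Real.rpow_sub_one hy.ne' _
  have e2 : y ^ s = y ^ (s - 1) * y := by
    rw [← Real.rpow_add_one hy.ne']; ring_nf
  rw [besselH, besselE, e1, e2]
  field_simp
  ring

lemma hasDerivAt_besselE (hs : 0 < s) {y : ℝ} (hy : 0 < y) :
    HasDerivAt (besselE s) (besselH s y - s * besselE s y / y) y := by
  have h1 := ((Real.hasDerivAt_rpow_const (p := s) (Or.inl hy.ne')).div_const 2).mul
    (hasDerivAt_besselClifford (by positivity : 0 < 2 * s + 1) y)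
  refine h1.congr_deriv ?_
  have e2 : y ^ s = y ^ (s - 1) * y := by
    rw [← Real.rpow_add_one hy.ne']; ring_nf
  have e3 := besselClifford_contiguous (by positivity : 0 < 2 * s) y
  rw [besselH, besselE, e2, show 2 * s + 1 + 1 = 2 * s + 2 by ring]
  generalize besselClifford (2 * s) y = A at *
  generalize besselClifford (2 * s + 1) y = B at *
  generalize besselClifford (2 * s + 2) y = D at *
  field_simp
  linear_combination (-1) * e3

lemma hasDerivAt_mul_besselH (hs : 0 < s) {y : ℝ} (hy : 0 < y) :
    HasDerivAt (fun y => y * besselH s y) (besselW s y) y := by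
  refine ((hasDerivAt_id' y).mul (hasDerivAt_besselH hs hy)).congr_deriv ?_
  rw [besselW]
  field_simp
  ring

lemma continuous_besselE (hs : 0 < s) : Continuous (besselE s) :=
  ((Real.continuous_rpow_const hs.le).div_const 2).mul
    (continuous_besselClifford (by positivity))

lemma measurable_besselH (hs : 0 < s) : Measurable (besselH s) :=
  ((measurable_id.pow_const (s - 1)).div_const 2).mul
    (continuous_besselClifford (by positivity)).measurable

lemma measurable_besselW (hs : 0 < s) : Measurable (besselW s) :=
  ((measurable_besselH hs).const_mul s).sub (continuous_besselE hs).measurable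

lemma intervalIntegrable_besselH (hs : 0 < s) (a b : ℝ) :
    IntervalIntegrable (besselH s) volume a b :=
  ((intervalIntegral.intervalIntegrable_rpow' (by linarith)).div_const 2).mul_continuousOn
    (continuous_besselClifford (by positivity)).continuousOn

lemma continuous_besselPhi (hs : 0 < s) : Continuous (besselPhi s) :=
  intervalIntegral.continuous_primitive (intervalIntegrable_besselH hs) 0

lemma besselPhi_zero : besselPhi s 0 = 0 := intervalIntegral.integral_same

lemma hasDerivAt_besselPhi (hs : 0 < s) {x : ℝ} (hx : 0 < x) :
    HasDerivAt (besselPhi s) (besselH s x) x :=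
  intervalIntegral.integral_hasDerivAt_right (intervalIntegrable_besselH hs 0 x)
    (measurable_besselH hs).stronglyMeasurable.stronglyMeasurableAtFilter
    (hasDerivAt_besselH hs hx).continuousAt

/-- Near the origin the density behaves like `y ^ (s - 1)`. -/
lemma exists_abs_besselH_le (hs : 0 < s) (R : ℝ) :
    ∃ C, 0 ≤ C ∧ ∀ y, 0 < y → y ≤ R → |besselH s y| ≤ C * y ^ (s - 1) := by
  obtain ⟨C, hC⟩ := (isCompact_Icc (a := (0 : ℝ)) (b := R)).exists_bound_of_continuousOn
    (continuous_besselClifford (by positivity : 0 < 2 * s)).continuousOn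
  refine ⟨|C|, abs_nonneg _, fun y hy hyR => ?_⟩
  have h1 := (hC y ⟨hy.le, hyR⟩).trans (le_abs_self C)
  have h2 : 0 < y ^ (s - 1) := by positivity
  rw [Real.norm_eq_abs] at h1
  rw [besselH, abs_mul, abs_of_pos (by positivity : 0 < y ^ (s - 1) / 2)]
  nlinarith [abs_nonneg (besselClifford (2 * s) y)]

lemma exists_abs_besselW_le (hs : 0 < s) (R : ℝ) :
    ∃ C, 0 ≤ C ∧ ∀ y, 0 < y → y ≤ R → |besselW s y| ≤ C * y ^ (s - 1) := by
  obtain ⟨C, hC0, hC⟩ := exists_abs_besselH_le hs R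
  obtain ⟨D, hD⟩ := (isCompact_Icc (a := (0 : ℝ)) (b := R)).exists_bound_of_continuousOn
    (f := fun y => y / 2 * besselClifford (2 * s + 1) y)
    ((continuous_id.div_const 2).mul
      (continuous_besselClifford (by positivity : 0 < 2 * s + 1))).continuousOn
  refine ⟨s * C + |D|, by positivity, fun y hy hyR => ?_⟩
  have h1 := (hD y ⟨hy.le, hyR⟩).trans (le_abs_self D)
  have h2 : 0 < y ^ (s - 1) := by positivity
  have e2 : y ^ s = y ^ (s - 1) * y := by
    rw [← Real.rpow_add_one hy.ne']; ring_nf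
  have h3 : |besselE s y| ≤ |D| * y ^ (s - 1) := by
    have : besselE s y = y ^ (s - 1) * (y / 2 * besselClifford (2 * s + 1) y) := by
      rw [besselE, e2]; ring
    rw [this, abs_mul, abs_of_pos h2, mul_comm]
    exact mul_le_mul_of_nonneg_right h1 h2.le
  calc |besselW s y| ≤ |s * besselH s y| + |besselE s y| := abs_sub _ _
    _ ≤ s * (C * y ^ (s - 1)) + |D| * y ^ (s - 1) := by
        rw [abs_mul, abs_of_pos hs]
        gcongr
        exact hC y hy hyR
    _ = _ := by ring

/-! ### Growth at infinity -/

/-- A quadratic form `q³H² + qE² - (2s - 1/2) q H E` in `H = besselH s (q²)`, `E = besselE s (q²)`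
whose cross term is chosen so that all but an integrable error cancels in its derivative. -/
lemma hasDerivAt_bessel_energy (hs : 0 < s) {q : ℝ} (hq : 0 < q) :
    HasDerivAt (fun q => q ^ 3 * besselH s (q ^ 2) ^ 2 + q * besselE s (q ^ 2) ^ 2
      - (2 * s - 1 / 2) * (q * besselH s (q ^ 2) * besselE s (q ^ 2)))
      ((2 * s - 1 / 2) * (besselH s (q ^ 2) * besselE s (q ^ 2))) q := by
  have hq2 : 0 < q ^ 2 := by positivity
  have hH : HasDerivAt (fun q => besselH s (q ^ 2)) _ q :=
    HasDerivAt.comp (h := fun q : ℝ => q ^ 2) q (hasDerivAt_besselH hs hq2) (hasDerivAt_pow 2 q)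
  have hE : HasDerivAt (fun q => besselE s (q ^ 2)) _ q :=
    HasDerivAt.comp (h := fun q : ℝ => q ^ 2) q (hasDerivAt_besselE hs hq2) (hasDerivAt_pow 2 q)
  have h := (((hasDerivAt_pow 3 q).mul (hH.pow 2)).add ((hasDerivAt_id' q).mul (hE.pow 2))).sub
    ((((hasDerivAt_id' q).mul hH).mul hE).const_mul (2 * s - 1 / 2))
  refine h.congr_deriv ?_
  simp only [Nat.cast_ofNat, Nat.add_one_sub_one, pow_one, Pi.pow_apply, Pi.mul_apply]
  field_simp
  ring

lemma exists_bessel_energy_le (hs : 0 < s) :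
    ∃ C, 0 ≤ C ∧ ∀ q, 1 / 2 ≤ q →
      q ^ 3 * besselH s (q ^ 2) ^ 2 + q * besselE s (q ^ 2) ^ 2 ≤ C := by
  set κ := |2 * s - 1 / 2| with hκ
  set N : ℝ → ℝ := fun q => q ^ 3 * besselH s (q ^ 2) ^ 2 + q * besselE s (q ^ 2) ^ 2 with hN
  set Q : ℝ → ℝ := fun q => N q - (2 * s - 1 / 2) * (q * besselH s (q ^ 2) * besselE s (q ^ 2))
    with hQ
  have hQd : ∀ q, 0 < q →
      HasDerivAt Q ((2 * s - 1 / 2) * (besselH s (q ^ 2) * besselE s (q ^ 2))) q :=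
    fun q hq => hasDerivAt_bessel_energy hs hq
  have hκ0 : 0 ≤ κ := abs_nonneg _
  have hN0 : ∀ q, 0 < q → 0 ≤ N q := fun q hq => by simp only [hN]; positivity
  have hHE : ∀ q, 0 < q → |besselH s (q ^ 2) * besselE s (q ^ 2)| ≤ N q / (2 * q ^ 2) := by
    intro q hq
    rw [le_div_iff₀ (by positivity), abs_mul]
    have := mul_nonneg hq.le (sq_nonneg (q * |besselH s (q ^ 2)| - |besselE s (q ^ 2)|))
    simp only [hN]
    rw [← sq_abs (besselH s (q ^ 2)), ← sq_abs (besselE s (q ^ 2))]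
    nlinarith
  set q₀ : ℝ := max κ 1 with hq₀
  have hq₀1 : 1 ≤ q₀ := le_max_right _ _
  have hNQ : ∀ q, q₀ ≤ q → N q ≤ 2 * Q q := by
    intro q hq
    have hq0 : 0 < q := by linarith
    have hκq : κ ≤ q := (le_max_left _ _).trans hq
    have h1 : |(2 * s - 1 / 2) * (q * besselH s (q ^ 2) * besselE s (q ^ 2))| ≤ N q / 2 := by
      rw [mul_assoc q, abs_mul, abs_mul, abs_of_pos hq0, ← hκ]
      calc κ * (q * |besselH s (q ^ 2) * besselE s (q ^ 2)|)
          ≤ q * (q * (N q / (2 * q ^ 2))) := by gcongr; exact hHE q hq0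
        _ = N q / 2 := by field_simp
    have := (abs_le.1 h1).2
    simp only [hQ]; linarith
  have hanti : AntitoneOn (fun q => Q q * Real.exp (κ / q)) (Set.Ici q₀) := by
    have hd : ∀ q, 0 < q → HasDerivAt (fun q => Q q * Real.exp (κ / q))
        (((2 * s - 1 / 2) * (besselH s (q ^ 2) * besselE s (q ^ 2)) - κ / q ^ 2 * Q q)
          * Real.exp (κ / q)) q := by
      intro q hq
      have h1 : HasDerivAt (fun q => κ / q) (-(κ / q ^ 2)) q := by
        refine ((hasDerivAt_inv hq.ne').const_mul κ).congr_deriv ?_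
        ring
      refine ((hQd q hq).mul h1.exp).congr_deriv ?_
      ring
    refine antitoneOn_of_deriv_nonpos (convex_Ici _)
      (fun q hq => (hd q (by have := Set.mem_Ici.1 hq; linarith)).continuousAt.continuousWithinAt)
      (fun q hq => ?_) (fun q hq => ?_)
    all_goals
      rw [interior_Ici] at hq
      have hq' : q₀ < q := hq
      have hq0 : 0 < q := by linarith
    · exact (hd q hq0).differentiableAt.differentiableWithinAt
    · rw [(hd q hq0).deriv]
      refine mul_nonpos_of_nonpos_of_nonneg ?_ (Real.exp_pos _).le
      have h1 : (2 * s - 1 / 2) * (besselH s (q ^ 2) * besselE s (q ^ 2))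
          ≤ κ * (N q / (2 * q ^ 2)) := by
        refine (le_abs_self _).trans ?_
        rw [abs_mul]
        exact mul_le_mul_of_nonneg_left (hHE q hq0) hκ0
      have h2 : κ * (N q / (2 * q ^ 2)) ≤ κ / q ^ 2 * Q q := by
        rw [show κ * (N q / (2 * q ^ 2)) = κ / q ^ 2 * (N q / 2) by field_simp]
        have := hNQ q hq'.le
        gcongr; linarith
      linarith
  have hcont : ContinuousOn N (Set.Icc (1 / 2) q₀) := by
    intro q hq
    have hq0 : 0 < q := by have := hq.1; linarith
    have hq2 : 0 < q ^ 2 := by positivity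
    have c1 : ContinuousAt (fun q => besselH s (q ^ 2)) q :=
      ContinuousAt.comp (f := fun q : ℝ => q ^ 2) (hasDerivAt_besselH hs hq2).continuousAt
        (by fun_prop)
    have c2 : ContinuousAt (fun q => besselE s (q ^ 2)) q :=
      ContinuousAt.comp (f := fun q : ℝ => q ^ 2) (hasDerivAt_besselE hs hq2).continuousAt
        (by fun_prop)
    exact ContinuousAt.continuousWithinAt (by simp only [hN]; fun_prop)
  obtain ⟨C, hC⟩ := isCompact_Icc.exists_bound_of_continuousOn hcont
  refine ⟨max |C| (2 * (Q q₀ * Real.exp (κ / q₀))), (abs_nonneg C).trans (le_max_left _ _),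
    fun q hq => ?_⟩
  rcases le_total q q₀ with h | h
  · exact (le_abs_self _).trans (((hC q ⟨hq, h⟩).trans (le_abs_self C)).trans (le_max_left _ _))
  · refine le_trans ?_ (le_max_right _ _)
    have hq0 : 0 < q := by linarith
    have h1 := hanti (Set.mem_Ici.2 le_rfl) (Set.mem_Ici.2 h) h
    have h2 := hNQ q h
    have h3 : 1 ≤ Real.exp (κ / q) := Real.one_le_exp (by positivity)
    have h4 := hN0 q hq0
    simp only at h1
    nlinarith

/-- The decay `J_ν(z) = O(z^{-1/2})`, in the variable `y = z² / 4`. -/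
lemma exists_bessel_decay (hs : 0 < s) :
    ∃ C, 0 ≤ C ∧ ∀ y, 1 / 2 ≤ y →
      |besselH s y| ≤ C * y ^ (-(3 / 4) : ℝ) ∧ |besselE s y| ≤ C * y ^ (-(1 / 4) : ℝ) := by
  obtain ⟨C, hC0, hC⟩ := exists_bessel_energy_le hs
  refine ⟨√C, Real.sqrt_nonneg _, fun y hy => ?_⟩
  have hy0 : 0 < y := by linarith
  have hq : 1 / 2 ≤ √y := Real.le_sqrt_of_sq_le (by linarith)
  have h1 := hC (√y) hq
  rw [Real.sq_sqrt hy0.le] at h1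
  have e3 : √y ^ 3 = (y ^ (3 / 4 : ℝ)) ^ 2 := by
    rw [Real.sqrt_eq_rpow, ← Real.rpow_natCast, ← Real.rpow_natCast, ← Real.rpow_mul hy0.le,
      ← Real.rpow_mul hy0.le]
    norm_num
  have e1 : √y = (y ^ (1 / 4 : ℝ)) ^ 2 := by
    rw [Real.sqrt_eq_rpow, ← Real.rpow_natCast, ← Real.rpow_mul hy0.le]
    norm_num
  have n1 : 0 ≤ √y ^ 3 * besselH s y ^ 2 := by positivity
  have n2 : 0 ≤ √y * besselE s y ^ 2 := by positivity
  constructor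
  · have : |y ^ (3 / 4 : ℝ) * besselH s y| ≤ √C :=
      Real.abs_le_sqrt (by rw [mul_pow, ← e3]; linarith)
    rw [abs_mul, abs_of_pos (by positivity)] at this
    rw [Real.rpow_neg hy0.le, ← div_eq_mul_inv, le_div_iff₀ (by positivity), mul_comm]
    exact this
  · have : |y ^ (1 / 4 : ℝ) * besselE s y| ≤ √C :=
      Real.abs_le_sqrt (by rw [mul_pow, ← e1]; linarith)
    rw [abs_mul, abs_of_pos (by positivity)] at this
    rw [Real.rpow_neg hy0.le, ← div_eq_mul_inv, le_div_iff₀ (by positivity), mul_comm]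
    exact this

/-! ### The total mass of the edge density -/

lemma exists_besselPhi_limit (hs : 0 < s) :
    ∃ L, Tendsto (besselPhi s) atTop (𝓝 L) ∧
      ∃ C, 0 ≤ C ∧ ∀ y, 1 / 2 ≤ y → |besselPhi s y - L| ≤ C * y ^ (-(1 / 4) : ℝ) := by
  obtain ⟨C, hC0, hC⟩ := exists_bessel_decay hs
  have hd : ∀ y, 0 < y → HasDerivAt (fun y => besselPhi s y - besselE s y)
      (s * besselE s y / y) y := by
    intro y hy
    refine ((hasDerivAt_besselPhi hs hy).sub (hasDerivAt_besselE hs hy)).congr_deriv ?_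
    ring
  have hb : ∀ y, 1 / 2 ≤ y → ‖s * besselE s y / y‖ ≤ s * C * y ^ (-(5 / 4) : ℝ) := by
    intro y hy
    have hy0 : 0 < y := by linarith
    rw [Real.norm_eq_abs, abs_div, abs_mul, abs_of_pos hs, abs_of_pos hy0, div_le_iff₀ hy0,
      mul_assoc (s * C), ← Real.rpow_add_one hy0.ne', mul_assoc]
    norm_num
    exact mul_le_mul_of_nonneg_left (by simpa using (hC y hy).2) hs.le
  have hm : Measurable fun y => s * besselE s y / y :=
    ((continuous_besselE hs).measurable.const_mul s).div measurable_id
  have hrp : ∀ y, 1 / 2 ≤ y → IntegrableOn (fun y : ℝ => s * C * y ^ (-(5 / 4) : ℝ)) (Set.Ioi y) :=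
    fun y hy => (integrableOn_Ioi_rpow_of_lt (by norm_num) (by linarith)).const_mul _
  have hint : ∀ y, 1 / 2 ≤ y → IntegrableOn (fun y => s * besselE s y / y) (Set.Ioi y) := by
    intro y hy
    refine (hrp y hy).mono' hm.aestronglyMeasurable ?_
    exact (ae_restrict_mem measurableSet_Ioi).mono fun t ht => hb t (hy.trans (le_of_lt ht))
  have hlim := tendsto_limUnder_of_hasDerivAt_of_integrableOn_Ioi
    (fun y (hy : y ∈ Set.Ioi (1 / 2 : ℝ)) => hd y (by have := Set.mem_Ioi.1 hy; linarith))
    (hint _ le_rfl)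
  set L := limUnder atTop fun y => besselPhi s y - besselE s y
  have hE0 : Tendsto (besselE s) atTop (𝓝 0) := by
    have h0 : Tendsto (fun y : ℝ => C * y ^ (-(1 / 4) : ℝ)) atTop (𝓝 0) := by
      simpa using (tendsto_rpow_neg_atTop (by norm_num : (0 : ℝ) < 1 / 4)).const_mul C
    refine squeeze_zero_norm' ?_ h0
    filter_upwards [eventually_ge_atTop (1 / 2)] with y hy using (hC y hy).2
  refine ⟨L, by simpa using hlim.add hE0, C + 4 * s * C, by positivity, fun y hy => ?_⟩
  have hy0 : 0 < y := by linarith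
  have h1 := integral_Ioi_of_hasDerivAt_of_tendsto (a := y)
    (hd y hy0).continuousAt.continuousWithinAt
    (fun t (ht : t ∈ Set.Ioi y) => hd t (hy0.trans ht)) (hint y hy) hlim
  have h2 := norm_integral_le_of_norm_le (hrp y hy)
    ((ae_restrict_mem measurableSet_Ioi).mono fun t ht => hb t (hy.trans (le_of_lt ht)))
  rw [h1, integral_const_mul, integral_Ioi_rpow_of_lt (by norm_num) hy0, Real.norm_eq_abs] at h2
  norm_num at h2
  have h3 := (hC y hy).2
  calc |besselPhi s y - L|
      = |besselE s y - (L - (besselPhi s y - besselE s y))| := by ring_nf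
    _ ≤ |besselE s y| + |L - (besselPhi s y - besselE s y)| := abs_sub _ _
    _ ≤ C * y ^ (-(1 / 4) : ℝ) + 4 * s * C * y ^ (-(1 / 4) : ℝ) := by
        refine add_le_add h3 (h2.trans_eq ?_)
        ring_nf
    _ = _ := by ring

lemma exists_abs_besselPhi_le_const (hs : 0 < s) :
    ∃ C, 0 ≤ C ∧ ∀ y, 0 ≤ y → |besselPhi s y| ≤ C := by
  obtain ⟨L, -, C, hC0, hC⟩ := exists_besselPhi_limit hs
  obtain ⟨D, hD⟩ := (isCompact_Icc (a := (0 : ℝ)) (b := 1)).exists_bound_of_continuousOn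
    (continuous_besselPhi hs).continuousOn
  refine ⟨max |D| (C + |L|), (abs_nonneg _).trans (le_max_left _ _), fun y hy => ?_⟩
  rcases le_total y 1 with h | h
  · exact ((hD y ⟨hy, h⟩).trans (le_abs_self D)).trans (le_max_left _ _)
  · refine le_trans ?_ (le_max_right _ _)
    have h1 := hC y (by linarith)
    have h2 : y ^ (-(1 / 4) : ℝ) ≤ 1 := Real.rpow_le_one_of_one_le_of_nonpos h (by norm_num)
    have h3 : |besselPhi s y| ≤ |besselPhi s y - L| + |L| := by
      simpa using abs_add_le (besselPhi s y - L) L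
    nlinarith

lemma exists_abs_besselH_le_global (hs : 0 < s) :
    ∃ C, 0 ≤ C ∧ ∀ y, 0 < y → |besselH s y| ≤ C * (y ^ (s - 1) + 1) := by
  obtain ⟨C, hC0, hC⟩ := exists_bessel_decay hs
  obtain ⟨D, hD0, hD⟩ := exists_abs_besselH_le hs 1
  refine ⟨C + D, by positivity, fun y hy => ?_⟩
  have hp : 0 < y ^ (s - 1) := by positivity
  rcases le_total y 1 with h | h
  · have := hD y hy h
    nlinarith
  · have h1 := (hC y (by linarith)).1
    have h2 : y ^ (-(3 / 4) : ℝ) ≤ 1 := Real.rpow_le_one_of_one_le_of_nonpos h (by norm_num)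
    nlinarith

lemma integrable_prod_restrict_of_abs_le {f : ℝ → ℝ → ℝ} {G : ℝ × ℝ → ℝ} {S T : Set ℝ}
    (hS : MeasurableSet S) (hT : MeasurableSet T) (hf : Measurable (Function.uncurry f))
    (hG : Integrable G ((volume.restrict S).prod (volume.restrict T)))
    (h : ∀ x ∈ S, ∀ y ∈ T, |f x y| ≤ G (x, y)) :
    Integrable (Function.uncurry f) ((volume.restrict S).prod (volume.restrict T)) := by
  refine hG.mono' hf.aestronglyMeasurable ?_
  rw [Measure.prod_restrict]
  exact (ae_restrict_mem (hS.prod hT)).mono fun p hp => h p.1 hp.1 p.2 hp.2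

/-- The weight `y ^ (s - 1/2) * exp (-y)` is its own Hankel transform. -/
lemma integral_besselH_mul_exp (hs : 0 < s) {x : ℝ} (hx : 0 < x) :
    ∫ y in Set.Ioi (0 : ℝ), besselH s (x * y) * (y ^ s * Real.exp (-y))
      = x ^ (s - 1) * Real.exp (-x) / 2 := by
  have hΓ : ∀ k : ℕ, 0 < Real.Gamma (2 * s + k) := fun k => Real.Gamma_pos_of_pos (by positivity)
  have hxs : 0 < x ^ (s - 1) := by positivity
  set F : ℕ → ℝ → ℝ := fun k y => x ^ (s - 1) / 2 *
    ((-1 : ℝ) ^ k * x ^ k / ((k.factorial : ℝ) * Real.Gamma (2 * s + k))) *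
      (Real.exp (-y) * y ^ (2 * s + k - 1)) with hF
  have hint : ∀ k, IntegrableOn (F k) (Set.Ioi 0) := fun k =>
    (Real.GammaIntegral_convergent (by positivity : 0 < 2 * s + k)).const_mul _
  have hval : ∀ k, ∫ y in Set.Ioi (0 : ℝ), F k y
      = x ^ (s - 1) / 2 * ((-x) ^ k / k.factorial) := by
    intro k
    simp only [hF]
    rw [integral_const_mul, ← Real.Gamma_eq_integral (by positivity : 0 < 2 * s + k),
      neg_pow x]
    have := (hΓ k).ne'
    field_simp
  have hnorm : ∀ k, ∫ y in Set.Ioi (0 : ℝ), ‖F k y‖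
      = x ^ (s - 1) / 2 * (x ^ k / k.factorial) := by
    intro k
    have h1 : ∀ y ∈ Set.Ioi (0 : ℝ), ‖F k y‖ = x ^ (s - 1) / 2 *
      (x ^ k / ((k.factorial : ℝ) * Real.Gamma (2 * s + k))) *
        (Real.exp (-y) * y ^ (2 * s + k - 1)) := by
      intro y hy
      have hy0 : 0 < y := hy
      have := hΓ k
      simp only [hF, Real.norm_eq_abs, abs_mul, abs_div, abs_pow, abs_neg, abs_one, one_pow,
        one_mul]
      rw [abs_of_pos hx, abs_of_pos this, abs_of_pos hxs, abs_of_pos (Real.exp_pos _),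
        abs_of_pos (Real.rpow_pos_of_pos hy0 _)]
      simp
    rw [setIntegral_congr_fun measurableSet_Ioi h1, integral_const_mul,
      ← Real.Gamma_eq_integral (by positivity : 0 < 2 * s + k)]
    have := (hΓ k).ne'
    field_simp
  have key := hasSum_integral_of_summable_integral_norm (μ := volume.restrict (Set.Ioi 0))
    (F := F) hint (by
      simp only [hnorm]
      exact (Real.summable_pow_div_factorial x).mul_left _)
  have hL : ∫ y in Set.Ioi (0 : ℝ), besselH s (x * y) * (y ^ s * Real.exp (-y))
      = ∫ y in Set.Ioi (0 : ℝ), ∑' k, F k y := by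
    refine setIntegral_congr_fun measurableSet_Ioi fun y hy => ?_
    have hy0 : 0 < y := hy
    simp only [hF, besselH, besselClifford]
    rw [← tsum_mul_left, ← tsum_mul_right]
    congr 1; ext k
    have e1 : y ^ (2 * s + k - 1) = y ^ (s - 1) * y ^ s * y ^ k := by
      rw [← Real.rpow_natCast, ← Real.rpow_add hy0, ← Real.rpow_add hy0]; ring_nf
    rw [e1, Real.mul_rpow hx.le hy0.le, mul_pow]
    ring
  rw [hL, ← key.tsum_eq]
  simp only [hval]
  rw [tsum_mul_left, Real.exp_eq_exp_ℝ, NormedSpace.exp_eq_tsum_div]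
  ring

lemma integral_besselPhi_mul_exp (hs : 0 < s) {X : ℝ} (hX : 0 < X) :
    ∫ y in Set.Ioi (0 : ℝ), besselPhi s (X * y) * (Real.exp (-y) * y ^ (s - 1))
      = ∫ x in (0 : ℝ)..X, x ^ (s - 1) * Real.exp (-x) / 2 := by
  obtain ⟨C, hC0, hC⟩ := exists_abs_besselH_le_global hs
  have hint : Integrable
      (Function.uncurry fun x y => besselH s (x * y) * (y ^ s * Real.exp (-y)))
      ((volume.restrict (Set.uIoc 0 X)).prod (volume.restrict (Set.Ioi 0))) := by
    have g1 : IntegrableOn (fun x : ℝ => x ^ (s - 1)) (Set.uIoc 0 X) :=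
      intervalIntegrable_iff.1 (intervalIntegral.intervalIntegrable_rpow' (by linarith))
    have g2 : IntegrableOn (fun y : ℝ => Real.exp (-y) * y ^ (2 * s - 1)) (Set.Ioi 0) :=
      Real.GammaIntegral_convergent (by positivity)
    have g3 : IntegrableOn (fun y : ℝ => Real.exp (-y) * y ^ (s + 1 - 1)) (Set.Ioi 0) :=
      Real.GammaIntegral_convergent (by positivity)
    have g4 : IntegrableOn (fun _ : ℝ => (1 : ℝ)) (Set.uIoc 0 X) :=
      intervalIntegrable_iff.1 intervalIntegrable_const
    refine integrable_prod_restrict_of_abs_le measurableSet_uIoc measurableSet_Ioi ?_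
      (((g1.mul_prod g2).add (g4.mul_prod g3)).const_mul C) ?_
    · exact ((measurable_besselH hs).comp (measurable_fst.mul measurable_snd)).mul
        ((measurable_snd.pow_const s).mul (measurable_snd.neg.exp))
    · intro x hx y hy
      rw [Set.uIoc_of_le hX.le] at hx
      have hx0 : 0 < x := hx.1
      have hy0 : 0 < y := hy
      have e1 : (x * y) ^ (s - 1) * y ^ s = x ^ (s - 1) * y ^ (2 * s - 1) := by
        rw [Real.mul_rpow hx0.le hy0.le, mul_assoc, ← Real.rpow_add hy0]; ring_nf
      rw [abs_mul, abs_of_pos (by positivity : 0 < y ^ s * Real.exp (-y))]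
      calc |besselH s (x * y)| * (y ^ s * Real.exp (-y))
          ≤ C * ((x * y) ^ (s - 1) + 1) * (y ^ s * Real.exp (-y)) := by
            gcongr; exact hC _ (by positivity)
        _ = C * (((x * y) ^ (s - 1) * y ^ s) * Real.exp (-y) + y ^ s * Real.exp (-y)) := by ring
        _ = _ := by
            rw [e1]
            simp only [Pi.add_apply, add_sub_cancel_right]
            ring
  have hswap := intervalIntegral_integral_swap hint
  have hL : ∀ y ∈ Set.Ioi (0 : ℝ),
      ∫ x in (0 : ℝ)..X, besselH s (x * y) * (y ^ s * Real.exp (-y))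
        = besselPhi s (X * y) * (Real.exp (-y) * y ^ (s - 1)) := by
    intro y hy
    have hy0 : 0 < y := hy
    rw [intervalIntegral.integral_mul_const,
      intervalIntegral.integral_comp_mul_right (besselH s) hy0.ne', zero_mul, smul_eq_mul,
      Real.rpow_sub_one hy0.ne', besselPhi]
    ring
  rw [setIntegral_congr_fun measurableSet_Ioi hL] at hswap
  rw [← hswap]
  refine intervalIntegral.integral_congr_ae (ae_of_all _ fun x hx => ?_)
  rw [Set.uIoc_of_le hX.le] at hx
  exact integral_besselH_mul_exp hs hx.1

/-- `∫_0^∞ J_{2s-1}(2t) dt = 1/2`. The value is found by averaging the primitive over all scales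
against a self-dual weight, which turns it into a ratio of two Gamma integrals. -/
lemma tendsto_besselPhi (hs : 0 < s) : Tendsto (besselPhi s) atTop (𝓝 (1 / 2)) := by
  obtain ⟨L, hL, -⟩ := exists_besselPhi_limit hs
  obtain ⟨C, hC0, hC⟩ := exists_abs_besselPhi_le_const hs
  have hΓ : IntegrableOn (fun y : ℝ => Real.exp (-y) * y ^ (s - 1)) (Set.Ioi 0) :=
    Real.GammaIntegral_convergent hs
  have h1 : Tendsto (fun X : ℝ => ∫ y in Set.Ioi (0 : ℝ),
      besselPhi s (X * y) * (Real.exp (-y) * y ^ (s - 1))) atTop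
      (𝓝 (∫ y in Set.Ioi (0 : ℝ), L * (Real.exp (-y) * y ^ (s - 1)))) := by
    refine tendsto_integral_filter_of_dominated_convergence
      (fun y => C * (Real.exp (-y) * y ^ (s - 1))) ?_ ?_ (hΓ.const_mul C) ?_
    · refine Eventually.of_forall fun X => ?_
      exact (((continuous_besselPhi hs).measurable.comp (measurable_const.mul measurable_id)).mul
        (measurable_id.neg.exp.mul (measurable_id.pow_const (s - 1)))).aestronglyMeasurable
    · filter_upwards [eventually_gt_atTop 0] with X hX
      refine (ae_restrict_mem measurableSet_Ioi).mono fun y hy => ?_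
      have hy0 : 0 < y := hy
      rw [Real.norm_eq_abs, abs_mul, abs_of_pos (by positivity : 0 < Real.exp (-y) * y ^ (s - 1))]
      gcongr
      exact hC _ (by positivity)
    · refine (ae_restrict_mem measurableSet_Ioi).mono fun y hy => ?_
      exact (hL.comp (tendsto_id.atTop_mul_const hy)).mul_const _
  have h2 : Tendsto (fun X : ℝ => ∫ x in (0 : ℝ)..X, x ^ (s - 1) * Real.exp (-x) / 2) atTop
      (𝓝 (∫ x in Set.Ioi (0 : ℝ), x ^ (s - 1) * Real.exp (-x) / 2)) := by
    refine intervalIntegral_tendsto_integral_Ioi 0 ?_ tendsto_id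
    have : IntegrableOn (fun y : ℝ => Real.exp (-y) * y ^ (s - 1) / 2) (Set.Ioi 0) :=
      hΓ.div_const 2
    simpa only [mul_comm] using this
  have h3 := tendsto_nhds_unique (h1.congr' (by
    filter_upwards [eventually_gt_atTop 0] with X hX using integral_besselPhi_mul_exp hs hX)) h2
  have h4 : ∫ x in Set.Ioi (0 : ℝ), x ^ (s - 1) * Real.exp (-x) / 2 = Real.Gamma s / 2 := by
    rw [Real.Gamma_eq_integral hs, ← integral_div]
    simp only [mul_comm]
  rw [integral_const_mul, ← Real.Gamma_eq_integral hs, h4] at h3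
  have h5 := (Real.Gamma_pos_of_pos hs).ne'
  have : L = 1 / 2 := by field_simp at h3 ⊢; linarith
  exact this ▸ hL

lemma exists_abs_besselPhi_sub_half_le (hs : 0 < s) :
    ∃ C, 0 ≤ C ∧ ∀ y, 1 / 2 ≤ y → |besselPhi s y - 1 / 2| ≤ C * y ^ (-(1 / 4) : ℝ) := by
  obtain ⟨L, hL, h⟩ := exists_besselPhi_limit hs
  rwa [tendsto_nhds_unique hL (tendsto_besselPhi hs)] at h

/-! ### Integrals over scales, and Lommel's integral -/

lemma continuous_mul_besselH (hs : 0 < s) : Continuous fun y => y * besselH s y := by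
  have : (fun y => y * besselH s y) = fun y => y ^ s / 2 * besselClifford (2 * s) y := by
    ext y
    rcases eq_or_ne y 0 with rfl | hy
    · simp [Real.zero_rpow hs.ne']
    · have : y ^ s = y ^ (s - 1) * y := by rw [← Real.rpow_add_one hy]; ring_nf
      rw [besselH, this]; ring
  rw [this]
  exact ((Real.continuous_rpow_const hs.le).div_const 2).mul
    (continuous_besselClifford (by positivity))

lemma continuous_mul_besselH_comp (hs : 0 < s) {c : ℝ} (hc : 0 < c) :
    Continuous fun t => t * besselH s (c * t) := by
  have h1 : (fun t => t * besselH s (c * t)) = fun t => c⁻¹ * (c * t * besselH s (c * t)) := by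
    ext t; field_simp
  rw [h1]
  exact continuous_const.mul ((continuous_mul_besselH hs).comp (continuous_const.mul
    continuous_id))

lemma exists_abs_mul_besselH_comp_le (hs : 0 < s) (T : ℝ) {x : ℝ} (hx : 0 < x) :
    ∃ D, 0 ≤ D ∧ ∀ u ∈ Set.Ioo (x / 2) (2 * x), ∀ t ∈ Set.Ioc 0 T,
      |t * besselH s (u * t)| ≤ D * t ^ s := by
  obtain ⟨C, hC0, hC⟩ := exists_abs_besselH_le hs (2 * x * T)
  refine ⟨C * ((x / 2) ^ (s - 1) + (2 * x) ^ (s - 1)), by positivity, fun u hu t ht => ?_⟩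
  have hu0 : 0 < u := by have := hu.1; linarith
  have ht0 : 0 < t := ht.1
  have h1 := hC (u * t) (by positivity) (by
    have := hu.2; have := ht.2; have : 0 < T := ht0.trans_le ht.2
    gcongr)
  have h2 : u ^ (s - 1) ≤ (x / 2) ^ (s - 1) + (2 * x) ^ (s - 1) := by
    have p1 : 0 < (x / 2) ^ (s - 1) := by positivity
    have p2 : 0 < (2 * x) ^ (s - 1) := by positivity
    rcases le_total 0 (s - 1) with h | h
    · have := Real.rpow_le_rpow hu0.le hu.2.le h
      linarith
    · have := Real.rpow_le_rpow_of_nonpos (by positivity : 0 < x / 2) hu.1.le h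
      linarith
  have e1 : t ^ s = t ^ (s - 1) * t := by rw [← Real.rpow_add_one ht0.ne']; ring_nf
  have p3 : 0 < t ^ (s - 1) := by positivity
  rw [abs_mul, abs_of_pos ht0, e1]
  calc t * |besselH s (u * t)| ≤ t * (C * (u * t) ^ (s - 1)) := by gcongr
    _ = C * u ^ (s - 1) * (t ^ (s - 1) * t) := by rw [Real.mul_rpow hu0.le ht0.le]; ring
    _ ≤ _ := by gcongr

section ScaleIntegral

variable {g : ℝ → ℝ} {T C : ℝ}

lemma intervalIntegrable_of_abs_le_rpow (hs : 0 < s) (hT : 0 ≤ T) (hg : Measurable g)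
    (hgC : ∀ t ∈ Set.Ioc 0 T, |g t| ≤ C * t ^ (s - 1)) : IntervalIntegrable g volume 0 T := by
  refine ((intervalIntegral.intervalIntegrable_rpow' (by linarith : -1 < s - 1)).const_mul
    C).mono_fun' hg.aestronglyMeasurable ?_
  rw [Set.uIoc_of_le hT]
  exact (ae_restrict_mem measurableSet_Ioc).mono hgC

lemma abs_mul_scale_le (hC : 0 ≤ C) {D t a b : ℝ} (ht : 0 < t)
    (ha : |a| ≤ C * t ^ (s - 1)) (hb : |b| ≤ D * t ^ s) :
    ‖a * b‖ ≤ C * D * t ^ (2 * s - 1) := by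
  have e1 : t ^ (2 * s - 1) = t ^ (s - 1) * t ^ s := by rw [← Real.rpow_add ht]; ring_nf
  rw [Real.norm_eq_abs, abs_mul, e1]
  calc |a| * |b| ≤ C * t ^ (s - 1) * (D * t ^ s) := by gcongr
    _ = _ := by ring

lemma measurable_mul_scale (hs : 0 < s) (hg : Measurable g) (x : ℝ) :
    Measurable fun t => g t * (t * besselH s (x * t)) :=
  hg.mul (measurable_id.mul ((measurable_besselH hs).comp (measurable_const.mul measurable_id)))

lemma hasDerivAt_integral_mul_besselPhi (hs : 0 < s) (hT : 0 ≤ T) (hg : Measurable g)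
    (hC : 0 ≤ C) (hgC : ∀ t ∈ Set.Ioc 0 T, |g t| ≤ C * t ^ (s - 1)) {x : ℝ} (hx : 0 < x) :
    IntervalIntegrable (fun t => g t * (t * besselH s (x * t))) volume 0 T ∧
      HasDerivAt (fun x => ∫ t in (0 : ℝ)..T, g t * besselPhi s (x * t))
        (∫ t in (0 : ℝ)..T, g t * (t * besselH s (x * t))) x := by
  obtain ⟨D, hD0, hD⟩ := exists_abs_mul_besselH_comp_le hs T hx
  have hmeas : ∀ x, Measurable fun t => g t * besselPhi s (x * t) := fun x =>
    hg.mul ((continuous_besselPhi hs).measurable.comp (measurable_const.mul measurable_id))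
  refine intervalIntegral.hasDerivAt_integral_of_dominated_loc_of_deriv_le
    (bound := fun t => C * D * t ^ (2 * s - 1))
    (F' := fun x t => g t * (t * besselH s (x * t)))
    (Ioo_mem_nhds (by linarith : x / 2 < x) (by linarith : x < 2 * x)) ?_ ?_ ?_ ?_ ?_ ?_
  · exact Eventually.of_forall fun x => (hmeas x).aestronglyMeasurable
  · exact (intervalIntegrable_of_abs_le_rpow hs hT hg hgC).mul_continuousOn
      ((continuous_besselPhi hs).comp (continuous_const.mul continuous_id)).continuousOn
  · exact (measurable_mul_scale hs hg x).aestronglyMeasurable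
  · rw [Set.uIoc_of_le hT]
    exact ae_of_all _ fun t ht u hu => abs_mul_scale_le hC ht.1 (hgC t ht) (hD u hu t ht)
  · exact (intervalIntegral.intervalIntegrable_rpow' (by linarith)).const_mul _
  · rw [Set.uIoc_of_le hT]
    refine ae_of_all _ fun t ht u hu => ?_
    have hu0 : 0 < u := by have := hu.1; linarith
    have h1 : HasDerivAt (fun x => besselPhi s (x * t)) (besselH s (u * t) * (1 * t)) u :=
      HasDerivAt.comp (h := fun x : ℝ => x * t) u (hasDerivAt_besselPhi hs (mul_pos hu0 ht.1))
        ((hasDerivAt_id' u).mul_const t)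
    exact (h1.const_mul (g t)).congr_deriv (by ring)

lemma continuousAt_integral_mul_besselH (hs : 0 < s) (hT : 0 ≤ T) (hg : Measurable g)
    (hC : 0 ≤ C) (hgC : ∀ t ∈ Set.Ioc 0 T, |g t| ≤ C * t ^ (s - 1)) {x : ℝ} (hx : 0 < x) :
    ContinuousAt (fun x => ∫ t in (0 : ℝ)..T, g t * (t * besselH s (x * t))) x := by
  obtain ⟨D, hD0, hD⟩ := exists_abs_mul_besselH_comp_le hs T hx
  refine intervalIntegral.continuousAt_of_dominated_interval
    (bound := fun t => C * D * t ^ (2 * s - 1)) ?_ ?_ ?_ ?_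
  · exact Eventually.of_forall fun x => (measurable_mul_scale hs hg x).aestronglyMeasurable
  · filter_upwards [Ioo_mem_nhds (by linarith : x / 2 < x) (by linarith : x < 2 * x)] with u hu
    rw [Set.uIoc_of_le hT]
    exact ae_of_all _ fun t ht => abs_mul_scale_le hC ht.1 (hgC t ht) (hD u hu t ht)
  · exact (intervalIntegral.intervalIntegrable_rpow' (by linarith)).const_mul _
  · rw [Set.uIoc_of_le hT]
    refine ae_of_all _ fun t ht => ?_
    refine continuousAt_const.mul (continuousAt_const.mul ?_)
    exact ContinuousAt.comp (f := fun x : ℝ => x * t)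
      (hasDerivAt_besselH hs (mul_pos hx ht.1)).continuousAt (by fun_prop)

end ScaleIntegral

lemma exists_abs_besselH_comp_le (hs : 0 < s) (T : ℝ) {a : ℝ} (ha : 0 < a) :
    ∃ C, 0 ≤ C ∧ ∀ t ∈ Set.Ioc 0 T, |besselH s (a * t)| ≤ C * t ^ (s - 1) := by
  obtain ⟨C, hC0, hC⟩ := exists_abs_besselH_le hs (a * T)
  refine ⟨C * a ^ (s - 1), by positivity, fun t ht => ?_⟩
  refine (hC (a * t) (mul_pos ha ht.1) (by have := ht.2; gcongr)).trans_eq ?_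
  rw [Real.mul_rpow ha.le ht.1.le]; ring

lemma exists_abs_besselW_comp_le (hs : 0 < s) (T : ℝ) {a : ℝ} (ha : 0 < a) :
    ∃ C, 0 ≤ C ∧ ∀ t ∈ Set.Ioc 0 T, |besselW s (a * t)| ≤ C * t ^ (s - 1) := by
  obtain ⟨C, hC0, hC⟩ := exists_abs_besselW_le hs (a * T)
  refine ⟨C * a ^ (s - 1), by positivity, fun t ht => ?_⟩
  refine (hC (a * t) (mul_pos ha ht.1) (by have := ht.2; gcongr)).trans_eq ?_
  rw [Real.mul_rpow ha.le ht.1.le]; ring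

lemma measurable_besselH_comp (hs : 0 < s) (a : ℝ) : Measurable fun t => besselH s (a * t) :=
  (measurable_besselH hs).comp (measurable_const.mul measurable_id)

lemma measurable_besselW_comp (hs : 0 < s) (a : ℝ) : Measurable fun t => besselW s (a * t) :=
  (measurable_besselW hs).comp (measurable_const.mul measurable_id)

/-- Lommel's integral of a product of two Bessel functions of different scales. -/
lemma sub_mul_integral_besselH_mul (hs : 0 < s) {a b T : ℝ} (ha : 0 < a) (hb : 0 < b)
    (hT : 0 ≤ T) :
    (b - a) * ∫ t in (0 : ℝ)..T, besselH s (b * t) * (t * besselH s (a * t))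
      = T * (besselH s (a * T) * besselE s (b * T) - besselE s (a * T) * besselH s (b * T)) := by
  obtain ⟨C, hC0, hC⟩ := exists_abs_besselH_comp_le hs T hb
  have hint := (hasDerivAt_integral_mul_besselPhi hs hT (measurable_besselH_comp hs b) hC0 hC
    ha).1
  have hcE : ∀ c, Continuous fun t => besselE s (c * t) := fun c =>
    (continuous_besselE hs).comp (continuous_const.mul continuous_id)
  have hcont : Continuous fun t => t * besselH s (a * t) * besselE s (b * t)
      - besselE s (a * t) * (t * besselH s (b * t)) :=
    ((continuous_mul_besselH_comp hs ha).mul (hcE b)).sub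
      ((hcE a).mul (continuous_mul_besselH_comp hs hb))
  have key := intervalIntegral.integral_eq_sub_of_hasDerivAt_of_le hT hcont.continuousOn
    (f' := fun t => (b - a) * (besselH s (b * t) * (t * besselH s (a * t)))) ?_
    (hint.const_mul _)
  · rw [intervalIntegral.integral_const_mul] at key
    rw [key]; simp only [mul_zero, zero_mul, sub_self]; ring
  · intro t ht
    have ht0 : 0 < t := ht.1
    have dH : ∀ c, 0 < c → HasDerivAt (fun t => besselH s (c * t)) _ t := fun c hc =>
      HasDerivAt.comp (h := fun t : ℝ => c * t) t (hasDerivAt_besselH hs (mul_pos hc ht0))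
        ((hasDerivAt_id' t).const_mul c)
    have dE : ∀ c, 0 < c → HasDerivAt (fun t => besselE s (c * t)) _ t := fun c hc =>
      HasDerivAt.comp (h := fun t : ℝ => c * t) t (hasDerivAt_besselE hs (mul_pos hc ht0))
        ((hasDerivAt_id' t).const_mul c)
    refine ((((hasDerivAt_id' t).mul (dH a ha)).mul (dE b hb)).sub
      ((dE a ha).mul ((hasDerivAt_id' t).mul (dH b hb)))).congr_deriv ?_
    simp only [Pi.mul_apply]
    generalize besselH s (a * t) = A
    generalize besselH s (b * t) = B
    field_simp
    ring

/-! ### The pairing of two scales -/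

/-- The pairing `∫_0^R φ(r y) φ'(y) dy` of `φ = besselPhi s` at scale `r` with `φ' = besselH s`.
As `R → ∞` it tends to `0`, `1/8` or `1/4` according as `r < 1`, `r = 1` or `r > 1`. -/
def scalePairing (s R r : ℝ) : ℝ := ∫ y in (0 : ℝ)..R, besselH s y * besselPhi s (r * y)

lemma hasDerivAt_scalePairing (hs : 0 < s) {R r : ℝ} (hR : 0 ≤ R) (hr : 0 < r) :
    HasDerivAt (scalePairing s R)
      (∫ y in (0 : ℝ)..R, besselH s y * (y * besselH s (r * y))) r := by
  obtain ⟨C, hC0, hC⟩ := exists_abs_besselH_le hs R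
  exact (hasDerivAt_integral_mul_besselPhi hs hR (measurable_besselH hs) hC0
    (fun t ht => hC t ht.1 ht.2) hr).2

lemma tendsto_scalePairing_zero (hs : 0 < s) {R : ℝ} (hR : 0 ≤ R) :
    Tendsto (scalePairing s R) (𝓝[>] 0) (𝓝 0) := by
  obtain ⟨C, hC0, hC⟩ := exists_abs_besselPhi_le_const hs
  have : Tendsto (scalePairing s R) (𝓝[>] 0) (𝓝 (∫ y in (0 : ℝ)..R, besselH s y * 0)) := by
    refine intervalIntegral.tendsto_integral_filter_of_dominated_convergence
      (fun y => |besselH s y| * C) ?_ ?_ ((intervalIntegrable_besselH hs 0 R).abs.mul_const C) ?_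
    · exact Eventually.of_forall fun r => ((measurable_besselH hs).mul
        ((continuous_besselPhi hs).measurable.comp
          (measurable_const.mul measurable_id))).aestronglyMeasurable
    · filter_upwards [self_mem_nhdsWithin] with r hr
      rw [Set.uIoc_of_le hR]
      refine ae_of_all _ fun y hy => ?_
      rw [Real.norm_eq_abs, abs_mul]
      exact mul_le_mul_of_nonneg_left (hC _ (mul_pos hr hy.1).le) (abs_nonneg _)
    · refine ae_of_all _ fun y _ => Tendsto.const_mul _ ?_
      have h1 : Tendsto (fun r : ℝ => r * y) (𝓝 0) (𝓝 0) :=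
        (continuous_id.mul continuous_const).tendsto' _ _ (by simp)
      have h2 := ((continuous_besselPhi hs).tendsto 0).comp h1
      rw [besselPhi_zero] at h2
      exact h2.mono_left nhdsWithin_le_nhds
  simpa using this

lemma scalePairing_one (hs : 0 < s) {R : ℝ} (hR : 0 ≤ R) :
    scalePairing s R 1 = besselPhi s R ^ 2 / 2 := by
  have := intervalIntegral.integral_eq_sub_of_hasDerivAt_of_le hR
    (f := fun y => besselPhi s y ^ 2 / 2) (f' := fun y => besselH s y * besselPhi s (1 * y))
    (((continuous_besselPhi hs).pow 2).div_const 2).continuousOn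
    (fun y hy => (((hasDerivAt_besselPhi hs hy.1).pow 2).div_const 2).congr_deriv
      (by simp only [Nat.cast_ofNat, one_mul]; ring))
    ((intervalIntegrable_besselH hs 0 R).mul_continuousOn
      ((continuous_besselPhi hs).comp (continuous_const.mul continuous_id)).continuousOn)
  rw [scalePairing, this, besselPhi_zero]
  ring

lemma scalePairing_add_inv (hs : 0 < s) {R r : ℝ} (hR : 0 ≤ R) (hr : 0 < r) :
    scalePairing s R r = besselPhi s R * besselPhi s (r * R) - scalePairing s (r * R) r⁻¹ := by
  have hc : Continuous fun y => besselPhi s (r * y) :=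
    (continuous_besselPhi hs).comp (continuous_const.mul continuous_id)
  have i1 : IntervalIntegrable (fun y => besselH s y * besselPhi s (r * y)) volume 0 R :=
    (intervalIntegrable_besselH hs 0 R).mul_continuousOn hc.continuousOn
  have i2 : IntervalIntegrable (fun y => r * (besselH s (r * y) * besselPhi s (r⁻¹ * (r * y))))
      volume 0 R := by
    have h0 : IntervalIntegrable (fun y => besselH s (r * y)) volume 0 R := by
      have := (intervalIntegrable_besselH hs (r * 0) (r * R)).comp_mul_left (c := r)
      simpa [hr.ne'] using this
    exact (h0.mul_continuousOn ((continuous_besselPhi hs).comp (continuous_const.mul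
      (continuous_const.mul continuous_id))).continuousOn).const_mul r
  have key := intervalIntegral.integral_eq_sub_of_hasDerivAt_of_le hR
    (f := fun y => besselPhi s y * besselPhi s (r * y))
    (f' := fun y => besselH s y * besselPhi s (r * y)
      + r * (besselH s (r * y) * besselPhi s (r⁻¹ * (r * y))))
    ((continuous_besselPhi hs).mul hc).continuousOn
    (fun y hy => by
      have h1 : HasDerivAt (fun y => besselPhi s (r * y)) _ y :=
        HasDerivAt.comp (h := fun y : ℝ => r * y) y (hasDerivAt_besselPhi hs (mul_pos hr hy.1))
          ((hasDerivAt_id' y).const_mul r)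
      refine ((hasDerivAt_besselPhi hs hy.1).mul h1).congr_deriv ?_
      rw [inv_mul_cancel_left₀ hr.ne']
      ring) (i1.add i2)
  rw [intervalIntegral.integral_add i1 i2, intervalIntegral.integral_const_mul,
    intervalIntegral.integral_comp_mul_left (fun u => besselH s u * besselPhi s (r⁻¹ * u)) hr.ne',
    smul_eq_mul, mul_zero, mul_inv_cancel_left₀ hr.ne', besselPhi_zero] at key
  rw [scalePairing, scalePairing]
  linarith

/-- The asymptotic sizes of the Bessel quantities at a large scale `R`, all measured by powers of
`q = R ^ (-1/4)`. -/
lemma exists_bessel_scale_bounds (hs : 0 < s) :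
    ∃ C, 0 ≤ C ∧ ∀ R, 1 ≤ R → ∀ q, q = R ^ (-(1 / 4) : ℝ) →
      |besselH s R| ≤ C * q ^ 3 ∧ |besselW s R| ≤ C * q ∧
      (∀ y, 0 ≤ y → |besselPhi s y - 1 / 2| ≤ C) ∧
      (∀ y, R / 2 ≤ y → |besselPhi s y - 1 / 2| ≤ C * q) ∧
      (∀ y, 0 < y → y ≤ R → |y * besselH s y| ≤ C / q) ∧
      ∫ y in (0 : ℝ)..R, |besselH s y| ≤ C / q := by
  obtain ⟨C₁, hC₁0, hC₁⟩ := exists_bessel_decay hs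
  obtain ⟨C₂, hC₂0, hC₂⟩ := exists_abs_besselPhi_le_const hs
  obtain ⟨C₃, hC₃0, hC₃⟩ := exists_abs_besselPhi_sub_half_le hs
  obtain ⟨C₄, hC₄0, hC₄⟩ := exists_abs_besselH_le hs 1
  set I₁ := ∫ y in (0 : ℝ)..1, |besselH s y| with hI₁
  have hI₁0 : 0 ≤ I₁ := intervalIntegral.integral_nonneg zero_le_one fun _ _ => abs_nonneg _
  refine ⟨(s + 4) * C₁ + (C₂ + 1) + 2 * C₃ + C₄ + I₁, by positivity, fun R hR q hq => ?_⟩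
  have hsC₁ : 0 ≤ s * C₁ := by positivity
  have hR0 : 0 < R := by linarith
  have hq0 : 0 < q := hq ▸ Real.rpow_pos_of_pos hR0 _
  have hq1 : q ≤ 1 := hq ▸ Real.rpow_le_one_of_one_le_of_nonpos hR (by norm_num)
  have hq3 : R ^ (-(3 / 4) : ℝ) = q ^ 3 := by
    rw [hq, ← Real.rpow_natCast, ← Real.rpow_mul hR0.le]; norm_num
  have hqi : R ^ (1 / 4 : ℝ) = 1 / q := by
    rw [hq, Real.rpow_neg hR0.le, div_inv_eq_mul, one_mul]
  have hiq : 1 ≤ 1 / q := by rw [le_div_iff₀ hq0]; linarith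
  obtain ⟨hH, hE⟩ := hC₁ R (by linarith)
  rw [hq3] at hH
  rw [← hq] at hE
  refine ⟨?_, ?_, ?_, ?_, ?_, ?_⟩
  · refine hH.trans ?_
    gcongr; linarith
  · have h3 : q ^ 3 ≤ q := by
      have := pow_le_pow_of_le_one hq0.le hq1 (by norm_num : 1 ≤ 3)
      simpa using this
    calc |besselW s R| ≤ |s * besselH s R| + |besselE s R| := abs_sub _ _
      _ ≤ s * (C₁ * q) + C₁ * q := by
          rw [abs_mul, abs_of_pos hs]
          gcongr
          exact hH.trans (by gcongr)
      _ = (s * C₁ + C₁) * q := by ring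
      _ ≤ _ := mul_le_mul_of_nonneg_right (by linarith) hq0.le
  · intro y hy
    have := abs_sub (besselPhi s y) (1 / 2)
    have := hC₂ y hy
    rw [abs_of_pos (by norm_num : (0 : ℝ) < 1 / 2)] at *
    linarith
  · intro y hy
    refine (hC₃ y (by linarith)).trans ?_
    have h2 : y ^ (-(1 / 4) : ℝ) ≤ 2 * q := by
      have h := Real.rpow_le_rpow_of_nonpos (by positivity : 0 < R / 2) hy
        (by norm_num : (-(1 / 4) : ℝ) ≤ 0)
      refine h.trans ?_
      rw [Real.div_rpow hR0.le (by norm_num), ← hq, div_eq_mul_inv, mul_comm,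
        ← Real.rpow_neg (by norm_num), neg_neg]
      gcongr
      simpa using Real.rpow_le_rpow_of_exponent_le (by norm_num : (1 : ℝ) ≤ 2)
        (by norm_num : (1 / 4 : ℝ) ≤ 1)
    calc C₃ * y ^ (-(1 / 4) : ℝ) ≤ C₃ * (2 * q) := by gcongr
      _ = 2 * C₃ * q := by ring
      _ ≤ _ := by gcongr; linarith
  · intro y hy hyR
    rw [abs_mul, abs_of_pos hy, div_eq_mul_one_div]
    rcases le_total y 1 with h | h
    · have h1 := hC₄ y hy h
      have h2 : y * y ^ (s - 1) ≤ 1 := by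
        rw [mul_comm, ← Real.rpow_add_one hy.ne', sub_add_cancel]
        exact Real.rpow_le_one hy.le h hs.le
      calc y * |besselH s y| ≤ y * (C₄ * y ^ (s - 1)) := by gcongr
        _ = C₄ * (y * y ^ (s - 1)) := by ring
        _ ≤ C₄ * (1 / q) := by gcongr; linarith
        _ ≤ _ := by gcongr; linarith
    · have h1 := (hC₁ y (by linarith)).1
      have h2 : y * y ^ (-(3 / 4) : ℝ) ≤ 1 / q := by
        rw [mul_comm, ← Real.rpow_add_one hy.ne', ← hqi]
        norm_num
        exact Real.rpow_le_rpow hy.le hyR (by norm_num)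
      calc y * |besselH s y| ≤ y * (C₁ * y ^ (-(3 / 4) : ℝ)) := by gcongr
        _ = C₁ * (y * y ^ (-(3 / 4) : ℝ)) := by ring
        _ ≤ C₁ * (1 / q) := by gcongr
        _ ≤ _ := by gcongr; linarith
  · have hi := fun a b => (intervalIntegrable_besselH hs a b).abs
    rw [← intervalIntegral.integral_add_adjacent_intervals (hi 0 1) (hi 1 R)]
    have h1 : ∫ y in (1 : ℝ)..R, |besselH s y| ≤ ∫ y in (1 : ℝ)..R, C₁ * y ^ (-(3 / 4) : ℝ) :=
      intervalIntegral.integral_mono_on hR (hi 1 R)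
        ((intervalIntegral.intervalIntegrable_rpow' (by norm_num)).const_mul _)
        fun y hy => (hC₁ y (by have := hy.1; linarith)).1
    rw [intervalIntegral.integral_const_mul, integral_rpow (Or.inl (by norm_num)),
      show (-(3 / 4) + 1 : ℝ) = 1 / 4 by norm_num, hqi, Real.one_rpow] at h1
    rw [div_eq_mul_one_div]
    have h2 : C₁ * ((1 / q - 1) / (1 / 4)) ≤ 4 * C₁ * (1 / q) := by
      have : C₁ * ((1 / q - 1) / (1 / 4)) = 4 * C₁ * (1 / q) - 4 * C₁ := by ring
      linarith
    have h3 : I₁ ≤ I₁ * (1 / q) := le_mul_of_one_le_right hI₁0 hiq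
    calc I₁ + ∫ y in (1 : ℝ)..R, |besselH s y| ≤ (4 * C₁ + I₁) * (1 / q) := by linarith
      _ ≤ _ := by gcongr; linarith

/-- A function of `r` whose derivative, by Lommel's integral, is `1 - r` times that of
`scalePairing s R`. The primitive `besselPhi` enters minus its limit, which makes the function small
for large `R`. -/
def pairingNumerator (s R r : ℝ) : ℝ :=
  -besselW s R * (besselPhi s (r * R) - 1 / 2) + besselH s R * (r * R * besselH s (r * R))

lemma hasDerivAt_pairingNumerator (hs : 0 < s) {R r : ℝ} (hR : 0 < R) (hr : 0 < r) :
    HasDerivAt (pairingNumerator s R)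
      ((1 - r) * ∫ y in (0 : ℝ)..R, besselH s y * (y * besselH s (r * y))) r := by
  have hL := sub_mul_integral_besselH_mul hs hr one_pos hR.le
  simp only [one_mul] at hL
  rw [hL]
  have h1 : HasDerivAt (fun r => besselPhi s (r * R)) _ r :=
    HasDerivAt.comp (h := fun r : ℝ => r * R) r (hasDerivAt_besselPhi hs (mul_pos hr hR))
      ((hasDerivAt_id' r).mul_const R)
  have h2 : HasDerivAt (fun r => r * R * besselH s (r * R)) _ r :=
    HasDerivAt.comp (h₂ := fun y => y * besselH s y) (h := fun r : ℝ => r * R) r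
      (hasDerivAt_mul_besselH hs (mul_pos hr hR)) ((hasDerivAt_id' r).mul_const R)
  refine (((h1.sub_const (1 / 2)).const_mul (-besselW s R)).add
    (h2.const_mul (besselH s R))).congr_deriv ?_
  simp only [besselW]
  ring

lemma hasDerivAt_scalePairing_sub (hs : 0 < s) {R r : ℝ} (hR : 0 < R) (hr : 0 < r) (hr1 : r < 1) :
    HasDerivAt (fun r => scalePairing s R r - pairingNumerator s R r / (1 - r))
      (-(pairingNumerator s R r / (1 - r) ^ 2)) r := by
  have h0 : 1 - r ≠ 0 := by linarith
  refine ((hasDerivAt_scalePairing hs hR.le hr).sub ((hasDerivAt_pairingNumerator hs hR hr).div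
    ((hasDerivAt_id' r).const_sub 1) h0)).congr_deriv ?_
  generalize (∫ y in (0 : ℝ)..R, besselH s y * (y * besselH s (r * y))) = A
  field_simp
  ring

/-- Away from the diagonal `r = 1` the pairing decays, and the decay degenerates only like
`1 / (1 - r)`. -/
lemma exists_abs_scalePairing_le (hs : 0 < s) :
    ∃ K, 0 ≤ K ∧ ∀ R, 1 ≤ R → ∀ q, q = R ^ (-(1 / 4) : ℝ) → ∀ r, 0 < r → r < 1 →
      |scalePairing s R r| ≤ K * (q + q ^ 2 / (1 - r)) := by
  obtain ⟨C, hC0, hC⟩ := exists_bessel_scale_bounds hs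
  refine ⟨1 + 100 * C ^ 2, by positivity, fun R hR q hq r hr hr1 => ?_⟩
  obtain ⟨hH, hW, hφ, hφR, hyH, -⟩ := hC R hR q hq
  have hR0 : 0 < R := by linarith
  have hq0 : 0 < q := hq ▸ Real.rpow_pos_of_pos hR0 _
  have hq1 : q ≤ 1 := hq ▸ Real.rpow_le_one_of_one_le_of_nonpos hR (by norm_num)
  have hsecond : ∀ r, 0 < r → r ≤ 1 →
      |besselH s R * (r * R * besselH s (r * R))| ≤ C ^ 2 * q ^ 2 := by
    intro r hr hr1
    rw [abs_mul]
    calc |besselH s R| * |r * R * besselH s (r * R)| ≤ C * q ^ 3 * (C / q) := by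
          gcongr
          exact hyH _ (mul_pos hr hR0) (by nlinarith)
      _ = C ^ 2 * q ^ 2 := by field_simp
  have hsplit : ∀ r, |pairingNumerator s R r| ≤ |besselW s R| * |besselPhi s (r * R) - 1 / 2|
      + |besselH s R * (r * R * besselH s (r * R))| := by
    intro r
    refine (abs_add_le _ _).trans_eq ?_
    rw [abs_mul, abs_neg]
  have hN1 : ∀ r, 0 < r → r ≤ 1 → |pairingNumerator s R r| ≤ 2 * C ^ 2 * q := by
    intro r hr hr1
    have h1 : |besselW s R| * |besselPhi s (r * R) - 1 / 2| ≤ C * q * C := by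
      gcongr
      exact hφ _ (by positivity)
    have h2 : C ^ 2 * q ^ 2 ≤ C ^ 2 * q := by gcongr; nlinarith
    have := hsplit r
    have := hsecond r hr hr1
    nlinarith
  have hN2 : ∀ r, 1 / 2 ≤ r → r ≤ 1 → |pairingNumerator s R r| ≤ 2 * C ^ 2 * q ^ 2 := by
    intro r hr hr1
    have h1 : |besselW s R| * |besselPhi s (r * R) - 1 / 2| ≤ C * q * (C * q) := by
      gcongr
      exact hφR _ (by nlinarith)
    have := hsplit r
    have := hsecond r (by linarith) hr1
    nlinarith
  set G : ℝ → ℝ := fun r => scalePairing s R r - pairingNumerator s R r / (1 - r) with hG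
  -- Small scales: the derivative of `G` is `O(q)`, and the pairing vanishes at scale zero.
  have hsmall : ∀ r, 0 < r → r ≤ 1 / 2 → |scalePairing s R r| ≤ (1 + 20 * C ^ 2) * q := by
    intro r hr hr2
    have hev := (tendsto_scalePairing_zero hs hR0.le).eventually
      (Metric.ball_mem_nhds 0 hq0)
    obtain ⟨ε, hε, hε0, hεr⟩ := (hev.and (Ioo_mem_nhdsGT hr)).exists
    rw [dist_zero_right, Real.norm_eq_abs] at hε
    have hd := Convex.norm_image_sub_le_of_norm_hasDerivWithin_le (f := G)
      (f' := fun r => -(pairingNumerator s R r / (1 - r) ^ 2)) (s := Set.Icc ε r)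
      (C := 8 * C ^ 2 * q) (x := ε) (y := r)
      (fun t ht => (hasDerivAt_scalePairing_sub hs hR0 (hε0.trans_le ht.1)
        (by have := ht.2; linarith)).hasDerivWithinAt)
      (fun t ht => by
        have ht2 := ht.2
        have h1 : 1 / 4 ≤ (1 - t) ^ 2 := by nlinarith
        rw [norm_neg, Real.norm_eq_abs, abs_div, abs_of_pos (by linarith : 0 < (1 - t) ^ 2),
          div_le_iff₀ (by linarith)]
        have := hN1 t (hε0.trans_le ht.1) (by linarith)
        nlinarith [mul_nonneg (sq_nonneg C) hq0.le])
      (convex_Icc _ _) ⟨le_rfl, hεr.le⟩ ⟨hεr.le, le_rfl⟩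
    have h2 : ∀ t, 0 < t → t ≤ 1 / 2 → |pairingNumerator s R t / (1 - t)| ≤ 4 * C ^ 2 * q := by
      intro t ht ht2
      rw [abs_div, abs_of_pos (by linarith : 0 < 1 - t), div_le_iff₀ (by linarith)]
      have := hN1 t ht (by linarith)
      nlinarith [mul_nonneg (sq_nonneg C) hq0.le]
    have h3 := h2 r hr hr2
    have h4 := h2 ε hε0 (by linarith)
    have h5 : 8 * C ^ 2 * q * ‖r - ε‖ ≤ 8 * C ^ 2 * q := by
      rw [Real.norm_eq_abs, abs_of_pos (by linarith : 0 < r - ε)]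
      exact mul_le_of_le_one_right (by positivity) (by linarith)
    have h6 := hd.trans h5
    simp only [hG, Real.norm_eq_abs] at h6
    have hε' := hε.le
    rw [abs_le] at h3 h4 h6 hε' ⊢
    constructor <;> nlinarith [mul_nonneg (sq_nonneg C) hq0.le]
  have hP : 0 ≤ C ^ 2 * q := by positivity
  have hQ : 0 ≤ C ^ 2 * q ^ 2 := by positivity
  have hqr : 0 ≤ q ^ 2 / (1 - r) := div_nonneg (by positivity) (by linarith)
  rcases le_total r (1 / 2) with h | h
  · have := hsmall r hr h
    nlinarith [mul_nonneg (sq_nonneg C) hqr]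
  · have hm : 0 ≤ C ^ 2 * (q ^ 2 / (1 - r)) := by positivity
    -- Near the diagonal: compare the increment of `G` with a primitive of `1 / (1 - r) ^ 2`.
    have hB : ∀ t, t < 1 → HasDerivAt (fun t => 2 * C ^ 2 * q ^ 2 * (1 - t)⁻¹)
        (2 * C ^ 2 * q ^ 2 * (1 / (1 - t) ^ 2)) t := by
      intro t ht
      have h0 : 1 - t ≠ 0 := by linarith
      refine ((((hasDerivAt_id' t).const_sub 1).inv h0).const_mul _).congr_deriv ?_
      simp
    have hd := image_norm_le_of_norm_deriv_right_le_deriv_boundary' (f := fun t => G t - G (1 / 2))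
      (a := 1 / 2) (b := r) (f' := fun r => -(pairingNumerator s R r / (1 - r) ^ 2))
      (B := fun t => 2 * C ^ 2 * q ^ 2 * (1 - t)⁻¹)
      (B' := fun t => 2 * C ^ 2 * q ^ 2 * (1 / (1 - t) ^ 2))
      (fun t ht => ((hasDerivAt_scalePairing_sub hs hR0 (by have := ht.1; linarith)
        (ht.2.trans_lt hr1)).sub_const _).continuousAt.continuousWithinAt)
      (fun t ht => ((hasDerivAt_scalePairing_sub hs hR0 (by have := ht.1; linarith)
        (ht.2.trans hr1)).sub_const _).hasDerivWithinAt)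
      (by
        simp only [sub_self, norm_zero]
        positivity)
      (fun t ht => (hB t (ht.2.trans_lt hr1)).continuousAt.continuousWithinAt)
      (fun t ht => (hB t (ht.2.trans hr1)).hasDerivWithinAt)
      (fun t ht => by
        have ht1 : t < 1 := ht.2.trans hr1
        have h1 : 0 < (1 - t) ^ 2 := by have : 0 < 1 - t := by linarith
                                        positivity
        rw [norm_neg, Real.norm_eq_abs, abs_div, abs_of_pos h1, div_eq_mul_one_div]
        gcongr
        exact hN2 t ht.1 ht1.le)
      (x := r) ⟨h, le_rfl⟩
    have h1 := hN2 r h hr1.le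
    have h2 := hN2 (1 / 2) le_rfl (by norm_num)
    have h3 := hsmall (1 / 2) (by norm_num) le_rfl
    have h4 : |pairingNumerator s R r / (1 - r)| ≤ 2 * C ^ 2 * (q ^ 2 / (1 - r)) := by
      rw [abs_div, abs_of_pos (by linarith : 0 < 1 - r), ← mul_div_assoc]
      gcongr
    have h5 : q ^ 2 ≤ q := by nlinarith
    have h6 : C ^ 2 * q ^ 2 ≤ C ^ 2 * q := by gcongr
    have e : 2 * C ^ 2 * q ^ 2 * (1 - r)⁻¹ = 2 * C ^ 2 * (q ^ 2 / (1 - r)) := by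
      rw [div_eq_mul_inv]; ring
    simp only [hG, Real.norm_eq_abs] at hd
    rw [e] at hd
    generalize q ^ 2 / (1 - r) = m at *
    generalize pairingNumerator s R r / (1 - r) = N at *
    norm_num at hd
    rw [abs_le] at h2 h3 h4 hd ⊢
    constructor <;> nlinarith

lemma tendsto_scalePairing_of_lt_one (hs : 0 < s) {r : ℝ} (hr : 0 < r) (hr1 : r < 1) :
    Tendsto (fun R => scalePairing s R r) atTop (𝓝 0) := by
  obtain ⟨K, hK0, hK⟩ := exists_abs_scalePairing_le hs
  have h0 : Tendsto (fun R : ℝ => R ^ (-(1 / 4) : ℝ)) atTop (𝓝 0) :=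
    tendsto_rpow_neg_atTop (by norm_num : (0 : ℝ) < 1 / 4)
  have h1 : Tendsto (fun R : ℝ => K * (R ^ (-(1 / 4) : ℝ) + (R ^ (-(1 / 4) : ℝ)) ^ 2 / (1 - r)))
      atTop (𝓝 0) := by
    simpa using (h0.add ((h0.pow 2).div_const (1 - r))).const_mul K
  refine squeeze_zero_norm' ?_ h1
  filter_upwards [eventually_ge_atTop 1] with R hR using hK R hR _ rfl r hr hr1

lemma tendsto_scalePairing_one (hs : 0 < s) :
    Tendsto (fun R => scalePairing s R 1) atTop (𝓝 (1 / 8)) := by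
  have h1 : Tendsto (fun R => besselPhi s R ^ 2 / 2) atTop (𝓝 ((1 / 2) ^ 2 / 2)) :=
    ((tendsto_besselPhi hs).pow 2).div_const 2
  norm_num at h1
  refine h1.congr' ?_
  filter_upwards [eventually_ge_atTop 0] with R hR using (scalePairing_one hs hR).symm

lemma tendsto_scalePairing_of_one_lt (hs : 0 < s) {r : ℝ} (hr : 1 < r) :
    Tendsto (fun R => scalePairing s R r) atTop (𝓝 (1 / 4)) := by
  have hr0 : 0 < r := by linarith
  have hrR : Tendsto (fun R : ℝ => r * R) atTop atTop := tendsto_id.const_mul_atTop hr0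
  have h1 := ((tendsto_besselPhi hs).mul ((tendsto_besselPhi hs).comp hrR)).sub
    ((tendsto_scalePairing_of_lt_one hs (inv_pos.2 hr0) (inv_lt_one_of_one_lt₀ hr)).comp hrR)
  norm_num at h1
  refine h1.congr' ?_
  filter_upwards [eventually_ge_atTop 0] with R hR using (scalePairing_add_inv hs hR hr0).symm

/-- The pairing is bounded uniformly in the cut-off and in the scale. Within `R ^ (-1/2)` of the
diagonal the bound comes from the derivative in the scale, elsewhere from
`exists_abs_scalePairing_le`; scales beyond the diagonal reduce to those below it by parts. -/
lemma exists_abs_scalePairing_le_const (hs : 0 < s) :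
    ∃ K, 0 ≤ K ∧ ∀ R, 0 < R → ∀ r, 0 < r → |scalePairing s R r| ≤ K := by
  obtain ⟨C, hC0, hC⟩ := exists_bessel_scale_bounds hs
  obtain ⟨K, hK0, hK⟩ := exists_abs_scalePairing_le hs
  obtain ⟨D, hD0, hD⟩ := exists_abs_besselPhi_le_const hs
  set I₁ := ∫ y in (0 : ℝ)..1, |besselH s y| with hI₁
  have hI₁0 : 0 ≤ I₁ := intervalIntegral.integral_nonneg zero_le_one fun _ _ => abs_nonneg _
  have hcut : ∀ R, 0 < R → R ≤ 1 → ∀ r, 0 < r → |scalePairing s R r| ≤ I₁ * D := by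
    intro R hR hR1 r hr
    have h1 := intervalIntegral.norm_integral_le_of_norm_le (μ := volume)
      (f := fun y => besselH s y * besselPhi s (r * y))
      (g := fun y => |besselH s y| * D) hR.le
      (ae_of_all _ fun y hy => by
        rw [Real.norm_eq_abs, abs_mul]
        exact mul_le_mul_of_nonneg_left (hD _ (mul_pos hr hy.1).le) (abs_nonneg _))
      ((intervalIntegrable_besselH hs 0 R).abs.mul_const D)
    rw [intervalIntegral.integral_mul_const] at h1
    refine h1.trans (mul_le_mul_of_nonneg_right ?_ hD0)
    exact intervalIntegral.integral_mono_interval le_rfl hR.le hR1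
      (ae_of_all _ fun _ => abs_nonneg _) (intervalIntegrable_besselH hs 0 1).abs
  have hle : ∀ R, 1 ≤ R → ∀ r, 0 < r → r ≤ 1 →
      |scalePairing s R r| ≤ 3 * K + (D ^ 2 + 2 * C ^ 2) := by
    intro R hR r hr hr1
    have hR0 : 0 < R := by linarith
    obtain ⟨q, hq⟩ : ∃ q, q = R ^ (-(1 / 4) : ℝ) := ⟨_, rfl⟩
    have hq0 : 0 < q := hq ▸ Real.rpow_pos_of_pos hR0 _
    have hq1 : q ≤ 1 := hq ▸ Real.rpow_le_one_of_one_le_of_nonpos hR (by norm_num)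
    obtain ⟨-, -, -, -, hyH, hI⟩ := hC R hR q hq
    have hpos : 0 ≤ D ^ 2 + 2 * C ^ 2 := by positivity
    have hfar : ∀ m, r < 1 → q ^ 2 / (1 - r) ≤ m → m ≤ 2 →
        |scalePairing s R r| ≤ 3 * K + (D ^ 2 + 2 * C ^ 2) := by
      intro m h1 hm hm2
      have := hK R hR q hq r hr h1
      nlinarith
    rcases le_total r (1 / 2) with h | h
    · refine hfar 2 (by linarith) ?_ le_rfl
      rw [div_le_iff₀ (by linarith)]
      nlinarith
    rcases le_total (q ^ 2) (1 - r) with h' | h'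
    · have h1 : r < 1 := by have := pow_pos hq0 2; linarith
      refine hfar 1 h1 ?_ (by norm_num)
      rw [div_le_iff₀ (by linarith)]
      linarith
    · have hd := Convex.norm_image_sub_le_of_norm_hasDerivWithin_le (f := scalePairing s R)
        (f' := fun r => ∫ y in (0 : ℝ)..R, besselH s y * (y * besselH s (r * y)))
        (s := Set.Icc r 1) (C := C / q * (2 * C / q)) (x := 1) (y := r)
        (fun t ht => (hasDerivAt_scalePairing hs hR0.le (hr.trans_le ht.1)).hasDerivWithinAt)
        (fun t ht => by
          have ht0 : 0 < t := hr.trans_le ht.1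
          have h1 := intervalIntegral.norm_integral_le_of_norm_le (μ := volume)
            (f := fun y => besselH s y * (y * besselH s (t * y)))
            (g := fun y => |besselH s y| * (2 * C / q)) hR0.le
            (ae_of_all _ fun y hy => by
              rw [Real.norm_eq_abs, abs_mul]
              refine mul_le_mul_of_nonneg_left ?_ (abs_nonneg _)
              have h2 := hyH (t * y) (mul_pos ht0 hy.1)
                (by have := hy.2; have := hy.1; have := ht.2; nlinarith)
              rw [mul_assoc, abs_mul, abs_of_pos ht0] at h2
              have h3 : 1 / 2 ≤ t := h.trans ht.1
              have h4 : 0 ≤ |y * besselH s (t * y)| := abs_nonneg _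
              rw [mul_div_assoc]
              nlinarith)
            ((intervalIntegrable_besselH hs 0 R).abs.mul_const _)
          rw [intervalIntegral.integral_mul_const] at h1
          exact h1.trans (mul_le_mul_of_nonneg_right hI (by positivity)))
        (convex_Icc _ _) ⟨hr1, le_rfl⟩ ⟨le_rfl, hr1⟩
      have h1 : C / q * (2 * C / q) * ‖r - 1‖ ≤ 2 * C ^ 2 := by
        rw [Real.norm_eq_abs, abs_sub_comm, abs_of_nonneg (by linarith : 0 ≤ 1 - r)]
        calc C / q * (2 * C / q) * (1 - r) ≤ C / q * (2 * C / q) * q ^ 2 := by gcongr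
          _ = 2 * C ^ 2 := by field_simp
      have h2 : |scalePairing s R 1| ≤ D ^ 2 := by
        rw [scalePairing_one hs hR0.le, abs_of_nonneg (by positivity)]
        have := hD R hR0.le
        have h3 : besselPhi s R ^ 2 ≤ D ^ 2 := by
          rw [← sq_abs]; gcongr
        nlinarith [sq_nonneg (besselPhi s R)]
      have h3 := hd.trans h1
      rw [Real.norm_eq_abs] at h3
      rw [abs_le] at h2 h3 ⊢
      constructor <;> linarith
  have hall : ∀ R, 0 < R → ∀ r, 0 < r → r ≤ 1 →
      |scalePairing s R r| ≤ 3 * K + (D ^ 2 + 2 * C ^ 2) + I₁ * D := by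
    intro R hR r hr hr1
    have p1 : 0 ≤ I₁ * D := by positivity
    have p2 : 0 ≤ 3 * K + (D ^ 2 + 2 * C ^ 2) := by positivity
    rcases le_total R 1 with h | h
    · have := hcut R hR h r hr
      linarith
    · have := hle R h r hr hr1
      linarith
  refine ⟨D * D + (3 * K + (D ^ 2 + 2 * C ^ 2) + I₁ * D), by positivity, fun R hR r hr => ?_⟩
  have p3 : 0 ≤ D * D := by positivity
  rcases le_total r 1 with h | h
  · have := hall R hR r hr h
    linarith
  · rw [scalePairing_add_inv hs hR.le hr]
    refine (abs_sub _ _).trans (add_le_add ?_ (hall _ (mul_pos hr hR) _ (inv_pos.2 hr)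
      (inv_le_one_of_one_le₀ h)))
    rw [abs_mul]
    gcongr
    · exact hD _ hR.le
    · exact hD _ (mul_pos hr hR).le

/-! ### The symplectic kernel in terms of the edge density -/

lemma besselJ_two_mul_sqrt (s : ℝ) {y : ℝ} (hy : 0 < y) :
    besselJ (2 * s - 1) (2 * √y) = 2 * √y * besselH s y := by
  have e1 : √y ^ (2 * s - 1) = y ^ (s - 1) * √y := by
    rw [Real.sqrt_eq_rpow, ← Real.rpow_mul hy.le, ← Real.rpow_add hy]; ring_nf
  have e2 : ∀ k : ℕ, √y ^ (2 * k) = y ^ k := fun k => by rw [pow_mul, Real.sq_sqrt hy.le]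
  have e3 : ∀ k : ℕ, 2 * s - 1 + k + 1 = 2 * s + k := fun k => by ring
  rw [besselJ, besselH, besselClifford, mul_div_cancel_left₀ _ (two_ne_zero' ℝ), e1]
  simp only [e2, e3]
  ring

lemma besselJ_add_one_two_mul_sqrt (s : ℝ) {y : ℝ} (hy : 0 < y) :
    besselJ (2 * s - 1 + 1) (2 * √y) = 2 * besselE s y := by
  have e1 : √y ^ (2 * s - 1 + 1) = y ^ s := by
    rw [Real.sqrt_eq_rpow, ← Real.rpow_mul hy.le]; ring_nf
  have e2 : ∀ k : ℕ, √y ^ (2 * k) = y ^ k := fun k => by rw [pow_mul, Real.sq_sqrt hy.le]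
  have e3 : ∀ k : ℕ, 2 * s - 1 + 1 + k + 1 = 2 * s + 1 + k := fun k => by ring
  rw [besselJ, besselE, besselClifford, mul_div_cancel_left₀ _ (two_ne_zero' ℝ), e1]
  simp only [e2, e3]
  ring

lemma besselJ_two_mul_sqrt_div (s : ℝ) {y : ℝ} (hy : 0 < y) :
    besselJ (2 * s - 1) (2 * √y) / (2 * √y) = besselH s y := by
  have : 0 < √y := Real.sqrt_pos.2 hy
  rw [besselJ_two_mul_sqrt s hy]
  field_simp

lemma integral_besselJ (hs : 0 < s) {x : ℝ} (hx : 0 ≤ x) :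
    ∫ t in (0 : ℝ)..√x, besselJ (2 * s - 1) (2 * t) = besselPhi s x := by
  have hJ : ∀ t, 0 < t → besselJ (2 * s - 1) (2 * t) = 2 * t * besselH s (t ^ 2) := by
    intro t ht
    have := besselJ_two_mul_sqrt s (by positivity : 0 < t ^ 2)
    rwa [Real.sqrt_sq ht.le] at this
  obtain ⟨C, hC0, hC⟩ := exists_abs_besselH_le hs x
  have hint : IntervalIntegrable (fun t => 2 * t * besselH s (t ^ 2)) volume 0 √x := by
    refine ((intervalIntegral.intervalIntegrable_rpow' (by linarith : -1 < 2 * s - 1)).const_mul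
      (2 * C)).mono_fun' (((measurable_id.const_mul 2).mul
        ((measurable_besselH hs).comp (measurable_id.pow_const 2))).aestronglyMeasurable) ?_
    rw [Set.uIoc_of_le (Real.sqrt_nonneg x)]
    refine (ae_restrict_mem measurableSet_Ioc).mono fun t ht => ?_
    have ht0 : 0 < t := ht.1
    have h1 := hC (t ^ 2) (by positivity) ((Real.le_sqrt ht0.le hx).1 ht.2)
    have e1 : t ^ (2 * s - 1) = t * (t ^ 2) ^ (s - 1) := by
      rw [← Real.rpow_natCast, ← Real.rpow_mul ht0.le, mul_comm t, ← Real.rpow_add_one ht0.ne']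
      congr 1; push_cast; ring
    beta_reduce
    rw [Real.norm_eq_abs, abs_mul, abs_of_pos (by positivity : 0 < 2 * t), e1]
    calc 2 * t * |besselH s (t ^ 2)| ≤ 2 * t * (C * (t ^ 2) ^ (s - 1)) := by gcongr
      _ = _ := by ring
  have key := intervalIntegral.integral_eq_sub_of_hasDerivAt_of_le (Real.sqrt_nonneg x)
    (f := fun t => besselPhi s (t ^ 2))
    ((continuous_besselPhi hs).comp (continuous_pow 2)).continuousOn
    (fun t ht => by
      have h1 : HasDerivAt (fun t => besselPhi s (t ^ 2)) _ t :=
        HasDerivAt.comp (h := fun t : ℝ => t ^ 2) t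
          (hasDerivAt_besselPhi hs (pow_pos ht.1 2)) (hasDerivAt_pow 2 t)
      exact h1.congr_deriv (f' := besselH s (t ^ 2) * _) (g' := 2 * t * besselH s (t ^ 2))
        (by simp only [Nat.cast_ofNat, Nat.add_one_sub_one, pow_one]; ring)) hint
  rw [Real.sq_sqrt hx, zero_pow two_ne_zero, besselPhi_zero, sub_zero] at key
  rw [← key]
  refine intervalIntegral.integral_congr_ae (ae_of_all _ fun t ht => ?_)
  rw [Set.uIoc_of_le (Real.sqrt_nonneg x)] at ht
  exact hJ t ht.1

/-- The overlap `∫_0^1 t h(xt) h(yt) dt` of the density with itself at two scales: the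
determinantal Bessel kernel without its prefactor. -/
def scaleOverlap (s x y : ℝ) : ℝ := ∫ t in (0 : ℝ)..1, besselH s (x * t) * (t * besselH s (y * t))

lemma besselQuotient_four_mul (hs : 0 < s) {x y : ℝ} (hx : 0 < x) (hy : 0 < y) (hxy : x ≠ y) :
    besselQuotient (2 * s - 1) (4 * x) (4 * y) = √x * √y * scaleOverlap s x y := by
  have h4 : ∀ z : ℝ, √(4 * z) = 2 * √z := fun z => by
    rw [Real.sqrt_mul (by norm_num), show (4 : ℝ) = 2 ^ 2 by norm_num, Real.sqrt_sq (by norm_num)]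
  have hL := sub_mul_integral_besselH_mul hs hy hx zero_le_one
  simp only [mul_one, one_mul] at hL
  have h0 : x - y ≠ 0 := sub_ne_zero.2 hxy
  rw [besselQuotient, h4, h4, besselJ_two_mul_sqrt s hx, besselJ_two_mul_sqrt s hy,
    besselJ_add_one_two_mul_sqrt s hx, besselJ_add_one_two_mul_sqrt s hy, scaleOverlap,
    div_eq_iff (by intro h; apply h0; linarith)]
  linear_combination (-8 * √x * √y) * hL

lemma scaleOverlap_comm (s x y : ℝ) : scaleOverlap s x y = scaleOverlap s y x := by
  simp only [scaleOverlap]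
  congr 1; ext t; ring

lemma continuousAt_scaleOverlap (hs : 0 < s) {x y : ℝ} (hx : 0 < x) (hy : 0 < y) :
    ContinuousAt (scaleOverlap s x) y := by
  obtain ⟨C, hC0, hC⟩ := exists_abs_besselH_comp_le hs 1 hx
  exact continuousAt_integral_mul_besselH hs zero_le_one (measurable_besselH_comp hs x) hC0 hC hy

lemma besselKernel_four_mul (hs : 0 < s) {x y : ℝ} (hx : 0 < x) (hy : 0 < y) :
    besselKernel (2 * s - 1) (4 * x) (4 * y) = √x * √y * scaleOverlap s x y := by
  rcases eq_or_ne x y with rfl | hxy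
  · rw [besselKernel, if_pos rfl]
    refine Tendsto.limUnder_eq ?_
    have h1 : Tendsto (fun u : ℝ => u / 4) (𝓝[≠] (4 * x)) (𝓝 x) :=
      ((continuous_id.div_const (4 : ℝ)).tendsto' _ _ (by simp)).mono_left nhdsWithin_le_nhds
    have h2 : Tendsto (fun u => √(u / 4) * √x * scaleOverlap s x (u / 4)) (𝓝[≠] (4 * x))
        (𝓝 (√x * √x * scaleOverlap s x x)) :=
      (((Real.continuous_sqrt.tendsto x).comp h1).mul_const _).mul
        ((continuousAt_scaleOverlap hs hx hx).tendsto.comp h1)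
    refine h2.congr' ?_
    filter_upwards [self_mem_nhdsWithin, nhdsWithin_le_nhds (lt_mem_nhds (by linarith :
      (0 : ℝ) < 4 * x))] with u hu hu0
    have hne : u / 4 ≠ x := fun h => hu (by rw [Set.mem_singleton_iff, ← h]; ring)
    have := besselQuotient_four_mul hs (by positivity : 0 < u / 4) hx hne
    rw [mul_div_cancel₀ u (by norm_num : (4 : ℝ) ≠ 0)] at this
    rw [this, scaleOverlap_comm]
  · rw [besselKernel, if_neg (by simpa using hxy)]
    exact besselQuotient_four_mul hs hx hy hxy

lemma symplecticBesselScalar_eq (hs : 0 < s) {x y : ℝ} (hx : 0 < x) (hy : 0 < y) :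
    symplecticBesselScalar s x y = 2 * x * scaleOverlap s x y - besselPhi s x * besselH s y := by
  have h2 : 0 < √y := Real.sqrt_pos.2 hy
  rw [symplecticBesselScalar, besselKernel_four_mul hs hx hy, besselJ_two_mul_sqrt_div s hy,
    integral_besselJ hs hx.le, Real.sqrt_div hx.le]
  have h3 : 2 * (√x / √y) * (√x * √y * scaleOverlap s x y) = 2 * x * scaleOverlap s x y := by
    field_simp
    rw [Real.sq_sqrt hx.le, mul_comm]
  rw [h3]; ring

lemma hasDerivAt_mul_besselH_comp (hs : 0 < s) {c t : ℝ} (hc : 0 < c) (ht : 0 < t) :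
    HasDerivAt (fun t => t * besselH s (c * t)) (besselW s (c * t)) t := by
  have h1 : HasDerivAt (fun t => c * t * besselH s (c * t)) (besselW s (c * t) * (c * 1)) t :=
    HasDerivAt.comp (h₂ := fun y => y * besselH s y) (h := fun t : ℝ => c * t) t
      (hasDerivAt_mul_besselH hs (mul_pos hc ht)) ((hasDerivAt_id' t).const_mul c)
  have h2 : (fun t => t * besselH s (c * t)) = fun t => c⁻¹ * (c * t * besselH s (c * t)) := by
    ext t; field_simp
  rw [h2]
  refine (h1.const_mul c⁻¹).congr_deriv ?_
  field_simp

lemma continuous_besselPhi_comp (hs : 0 < s) (c : ℝ) : Continuous fun t => besselPhi s (c * t) :=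
  (continuous_besselPhi hs).comp (continuous_const.mul continuous_id)

lemma hasDerivAt_besselPhi_comp (hs : 0 < s) {c t : ℝ} (hc : 0 < c) (ht : 0 < t) :
    HasDerivAt (fun t => besselPhi s (c * t)) (c * besselH s (c * t)) t := by
  have h1 : HasDerivAt (fun t => besselPhi s (c * t)) _ t :=
    HasDerivAt.comp (h := fun t : ℝ => c * t) t (hasDerivAt_besselPhi hs (mul_pos hc ht))
      ((hasDerivAt_id' t).const_mul c)
  exact h1.congr_deriv (by ring)

lemma intervalIntegrable_besselH_comp (hs : 0 < s) {c : ℝ} (hc : 0 < c) (T : ℝ) :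
    IntervalIntegrable (fun t => besselH s (c * t)) volume 0 T := by
  have := (intervalIntegrable_besselH hs (c * 0) (c * T)).comp_mul_left (c := c)
  simpa [hc.ne'] using this

lemma intervalIntegrable_besselW_comp (hs : 0 < s) {c T : ℝ} (hc : 0 < c) (hT : 0 ≤ T) :
    IntervalIntegrable (fun t => besselW s (c * t)) volume 0 T := by
  obtain ⟨C, -, hC⟩ := exists_abs_besselW_comp_le hs T hc
  exact intervalIntegrable_of_abs_le_rpow hs hT (measurable_besselW_comp hs c) hC

lemma integral_besselW_comp (hs : 0 < s) {c : ℝ} (hc : 0 < c) :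
    ∫ t in (0 : ℝ)..1, besselW s (c * t) = besselH s c := by
  have := intervalIntegral.integral_eq_sub_of_hasDerivAt_of_le zero_le_one
    (continuous_mul_besselH_comp hs hc).continuousOn
    (fun t ht => hasDerivAt_mul_besselH_comp hs hc ht.1)
    (intervalIntegrable_besselW_comp hs hc zero_le_one)
  simpa using this

lemma integral_besselH_comp (s : ℝ) {c : ℝ} (hc : 0 < c) (T : ℝ) :
    ∫ t in (0 : ℝ)..T, besselH s (c * t) = besselPhi s (c * T) / c := by
  rw [intervalIntegral.integral_comp_mul_left (besselH s) hc.ne', mul_zero, smul_eq_mul, besselPhi]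
  ring

lemma mul_scaleOverlap (hs : 0 < s) {x y : ℝ} (hx : 0 < x) (hy : 0 < y) :
    x * scaleOverlap s x y = besselH s y * besselPhi s x
      - ∫ t in (0 : ℝ)..1, besselW s (y * t) * besselPhi s (x * t) := by
  obtain ⟨C, hC0, hC⟩ := exists_abs_besselH_comp_le hs 1 hx
  have i1 : IntervalIntegrable (fun t => x * (besselH s (x * t) * (t * besselH s (y * t))))
      volume 0 1 :=
    ((hasDerivAt_integral_mul_besselPhi hs zero_le_one (measurable_besselH_comp hs x) hC0 hC
      hy).1).const_mul x
  have i2 : IntervalIntegrable (fun t => besselW s (y * t) * besselPhi s (x * t)) volume 0 1 :=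
    (intervalIntegrable_besselW_comp hs hy zero_le_one).mul_continuousOn
      (continuous_besselPhi_comp hs x).continuousOn
  have key := intervalIntegral.integral_eq_sub_of_hasDerivAt_of_le zero_le_one
    (f := fun t => t * besselH s (y * t) * besselPhi s (x * t))
    (f' := fun t => x * (besselH s (x * t) * (t * besselH s (y * t)))
      + besselW s (y * t) * besselPhi s (x * t))
    ((continuous_mul_besselH_comp hs hy).mul (continuous_besselPhi_comp hs x)).continuousOn
    (fun t ht => ((hasDerivAt_mul_besselH_comp hs hy ht.1).mul
      (hasDerivAt_besselPhi_comp hs hx ht.1)).congr_deriv (by ring)) (i1.add i2)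
  rw [intervalIntegral.integral_add i1 i2, intervalIntegral.integral_const_mul] at key
  simp only [mul_one, one_mul, zero_mul, sub_zero] at key
  rw [scaleOverlap]
  linarith

/-- An expression of the scalar kernel that is smooth in its first variable under the integral. -/
lemma symplecticBesselScalar_eq_sub (hs : 0 < s) {x y : ℝ} (hx : 0 < x) (hy : 0 < y) :
    symplecticBesselScalar s x y = besselH s y * besselPhi s x
      - 2 * ∫ t in (0 : ℝ)..1, besselW s (y * t) * besselPhi s (x * t) := by
  have := mul_scaleOverlap hs hx hy
  rw [symplecticBesselScalar_eq hs hx hy]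
  linear_combination 2 * this

/-- The derivative of the scalar kernel in its first variable. -/
def symplecticBesselDeriv (s x y : ℝ) : ℝ :=
  besselH s y * besselH s x
    - 2 * ∫ t in (0 : ℝ)..1, besselW s (y * t) * (t * besselH s (x * t))

lemma hasDerivAt_symplecticBesselScalar_expr (hs : 0 < s) {x y : ℝ} (hx : 0 < x) (hy : 0 < y) :
    HasDerivAt (fun x => besselH s y * besselPhi s x
      - 2 * ∫ t in (0 : ℝ)..1, besselW s (y * t) * besselPhi s (x * t))
      (symplecticBesselDeriv s x y) x := by
  obtain ⟨C, hC0, hC⟩ := exists_abs_besselW_comp_le hs 1 hy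
  exact ((hasDerivAt_besselPhi hs hx).const_mul _).sub ((hasDerivAt_integral_mul_besselPhi hs
    zero_le_one (measurable_besselW_comp hs y) hC0 hC hx).2.const_mul 2)

lemma deriv_symplecticBesselScalar (hs : 0 < s) {x y : ℝ} (hx : 0 < x) (hy : 0 < y) :
    deriv (fun u => symplecticBesselScalar s u y) x = symplecticBesselDeriv s x y := by
  refine ((hasDerivAt_symplecticBesselScalar_expr hs hx hy).congr_of_eventuallyEq ?_).deriv
  filter_upwards [lt_mem_nhds hx] with u hu using symplecticBesselScalar_eq_sub hs hu hy

/-- The derivative of the kernel is antisymmetric. -/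
lemma symplecticBesselDeriv_antisymm (hs : 0 < s) {x y : ℝ} (hx : 0 < x) (hy : 0 < y) :
    symplecticBesselDeriv s x y = -symplecticBesselDeriv s y x := by
  have i : ∀ {x y : ℝ}, 0 < x → 0 < y → IntervalIntegrable
      (fun t => besselW s (y * t) * (t * besselH s (x * t))) volume 0 1 := by
    intro x y hx hy
    exact (intervalIntegrable_besselW_comp hs hy zero_le_one).mul_continuousOn
      (continuous_mul_besselH_comp hs hx).continuousOn
  have key := intervalIntegral.integral_eq_sub_of_hasDerivAt_of_le zero_le_one
    (f := fun t => t * besselH s (y * t) * (t * besselH s (x * t)))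
    (f' := fun t => besselW s (y * t) * (t * besselH s (x * t))
      + besselW s (x * t) * (t * besselH s (y * t)))
    ((continuous_mul_besselH_comp hs hy).mul (continuous_mul_besselH_comp hs hx)).continuousOn
    (fun t ht => ((hasDerivAt_mul_besselH_comp hs hy ht.1).mul
      (hasDerivAt_mul_besselH_comp hs hx ht.1)).congr_deriv (by ring)) ((i hx hy).add (i hy hx))
  rw [intervalIntegral.integral_add (i hx hy) (i hy hx)] at key
  simp only [mul_one, one_mul, zero_mul, sub_zero] at key
  rw [symplecticBesselDeriv, symplecticBesselDeriv]
  linear_combination (-2) * key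

/-- The off-diagonal entry `∫_y^x K(x, t) dt` of the kernel, in closed form. -/
def symplecticBesselPrimitive (s x y : ℝ) : ℝ :=
  besselPhi s x * besselPhi s y
    - 2 * x * ∫ t in (0 : ℝ)..1, besselH s (x * t) * besselPhi s (y * t)

lemma hasDerivAt_symplecticBesselPrimitive (hs : 0 < s) {x y : ℝ} (hx : 0 < x) (hy : 0 < y) :
    HasDerivAt (symplecticBesselPrimitive s x)
      (-(2 * x * scaleOverlap s x y - besselPhi s x * besselH s y)) y := by
  obtain ⟨C, hC0, hC⟩ := exists_abs_besselH_comp_le hs 1 hx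
  refine (((hasDerivAt_besselPhi hs hy).const_mul (besselPhi s x)).sub
    ((hasDerivAt_integral_mul_besselPhi hs zero_le_one (measurable_besselH_comp hs x) hC0 hC
      hy).2.const_mul (2 * x))).congr_deriv ?_
  rw [scaleOverlap]
  ring

lemma symplecticBesselPrimitive_self (hs : 0 < s) {x : ℝ} (hx : 0 < x) :
    symplecticBesselPrimitive s x x = 0 := by
  have h1 := intervalIntegral.integral_comp_mul_left (a := 0) (b := 1)
    (fun u => besselH s u * besselPhi s (1 * u)) hx.ne'
  have h2 := scalePairing_one hs hx.le
  rw [scalePairing] at h2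
  rw [mul_zero, mul_one, smul_eq_mul, h2] at h1
  simp only [one_mul] at h1
  rw [symplecticBesselPrimitive, h1]
  field_simp
  ring

lemma integral_symplecticBesselScalar (hs : 0 < s) {x y : ℝ} (hx : 0 < x) (hy : 0 < y) :
    ∫ t in y..x, symplecticBesselScalar s x t = symplecticBesselPrimitive s x y := by
  have hpos : ∀ t ∈ Set.uIcc y x, 0 < t := fun t ht => (lt_min hy hx).trans_le ht.1
  have hcont : ContinuousOn (fun t => 2 * x * scaleOverlap s x t - besselPhi s x * besselH s t)
      (Set.uIcc y x) := fun t ht =>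
    ((continuousAt_const.mul (continuousAt_scaleOverlap hs hx (hpos t ht))).sub
      (continuousAt_const.mul (hasDerivAt_besselH hs (hpos t ht)).continuousAt)).continuousWithinAt
  have key := intervalIntegral.integral_eq_sub_of_hasDerivAt
    (fun t ht => hasDerivAt_symplecticBesselPrimitive hs hx (hpos t ht))
    hcont.intervalIntegrable.neg
  rw [intervalIntegral.integral_neg, symplecticBesselPrimitive_self hs hx] at key
  rw [intervalIntegral.integral_congr fun t ht => symplecticBesselScalar_eq hs hx (hpos t ht)]
  linarith

lemma det_symplecticBesselKernel (hs : 0 < s) {x y : ℝ} (hx : 0 < x) (hy : 0 < y) :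
    (symplecticBesselKernel s x y).det =
      (2 * x * scaleOverlap s x y - besselPhi s x * besselH s y)
        * (besselH s x * besselPhi s y
          - 2 * ∫ t in (0 : ℝ)..1, besselW s (x * t) * besselPhi s (y * t))
      + symplecticBesselPrimitive s x y * symplecticBesselDeriv s y x := by
  rw [symplecticBesselKernel, Matrix.det_fin_two_of, deriv_symplecticBesselScalar hs hx hy,
    integral_symplecticBesselScalar hs hx hy, symplecticBesselScalar_eq hs hx hy,
    symplecticBesselScalar_eq_sub hs hy hx, symplecticBesselDeriv_antisymm hs hx hy]
  ring

/-! ### Limits of the cut-off integrals -/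

section Scale

variable {g : ℝ → ℝ} {T : ℝ}

lemma continuous_integral_mul_besselPhi (hs : 0 < s) (hT : 0 ≤ T)
    (hg : IntervalIntegrable g volume 0 T) :
    Continuous fun x => ∫ t in (0 : ℝ)..T, g t * besselPhi s (x * t) := by
  refine continuous_iff_continuousAt.2 fun x => ?_
  obtain ⟨C, hC⟩ := (isCompact_Icc (a := -((|x| + 1) * T)) (b := (|x| + 1) * T)
    ).exists_bound_of_continuousOn (continuous_besselPhi hs).continuousOn
  refine intervalIntegral.continuousAt_of_dominated_interval (bound := fun t => |g t| * C)
    ?_ ?_ (hg.abs.mul_const C) ?_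
  · refine Eventually.of_forall fun u => ?_
    exact (intervalIntegrable_iff.1
      (hg.mul_continuousOn (continuous_besselPhi_comp hs u).continuousOn)).aestronglyMeasurable
  · filter_upwards [Metric.ball_mem_nhds x one_pos] with u hu
    refine ae_of_all _ fun t ht => ?_
    rw [Set.uIoc_of_le hT] at ht
    rw [norm_mul]
    refine mul_le_mul_of_nonneg_left (hC _ (abs_le.1 ?_)) (norm_nonneg _)
    have h1 : |u| ≤ |x| + 1 := by
      rw [Metric.mem_ball, Real.dist_eq] at hu
      have := abs_add_le (u - x) x
      rw [sub_add_cancel] at this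
      linarith
    rw [abs_mul, abs_of_pos ht.1]
    have := ht.2
    have := ht.1
    gcongr
  · refine ae_of_all _ fun t _ => continuousAt_const.mul ?_
    exact ((continuous_besselPhi hs).comp (continuous_id.mul continuous_const)).continuousAt

lemma tendsto_integral_mul_besselPhi (hs : 0 < s) (hT : 0 ≤ T)
    (hg : IntervalIntegrable g volume 0 T) :
    Tendsto (fun x => ∫ t in (0 : ℝ)..T, g t * besselPhi s (x * t)) atTop
      (𝓝 ((∫ t in (0 : ℝ)..T, g t) * (1 / 2))) := by
  obtain ⟨C, hC0, hC⟩ := exists_abs_besselPhi_le_const hs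
  rw [← intervalIntegral.integral_mul_const]
  refine intervalIntegral.tendsto_integral_filter_of_dominated_convergence
    (fun t => |g t| * C) ?_ ?_ (hg.abs.mul_const C) ?_
  · refine Eventually.of_forall fun u => ?_
    exact (intervalIntegrable_iff.1
      (hg.mul_continuousOn (continuous_besselPhi_comp hs u).continuousOn)).aestronglyMeasurable
  · filter_upwards [eventually_ge_atTop 0] with u hu
    refine ae_of_all _ fun t ht => ?_
    rw [Set.uIoc_of_le hT] at ht
    rw [norm_mul]
    exact mul_le_mul_of_nonneg_left (hC _ (mul_nonneg hu ht.1.le)) (norm_nonneg _)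
  · refine ae_of_all _ fun t ht => ?_
    rw [Set.uIoc_of_le hT] at ht
    exact ((tendsto_besselPhi hs).comp (tendsto_id.atTop_mul_const ht.1)).const_mul _

/-- As a function of the scale, `∫ g(t) t h(yt) dt` has at most the singularity `y ^ (s - 1)` of
`h = besselH s` at the origin. -/
lemma intervalIntegrable_integral_mul_besselH (hs : 0 < s) {C R : ℝ} (hR : 0 ≤ R)
    (hg : Measurable g) (hC : 0 ≤ C) (hgC : ∀ t ∈ Set.Ioc (0 : ℝ) 1, |g t| ≤ C * t ^ (s - 1)) :
    IntervalIntegrable (fun y => ∫ t in (0 : ℝ)..1, g t * (t * besselH s (y * t))) volume 0 R := by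
  obtain ⟨D, hD0, hD⟩ := exists_abs_besselH_le hs R
  have hi : IntervalIntegrable (fun t : ℝ => t ^ (2 * s - 1)) volume 0 1 :=
    intervalIntegral.intervalIntegrable_rpow' (by linarith)
  refine ((intervalIntegral.intervalIntegrable_rpow' (by linarith : -1 < s - 1)).const_mul
    (C * D * ∫ t in (0 : ℝ)..1, t ^ (2 * s - 1))).mono_fun' ?_ ?_
  · rw [Set.uIoc_of_le hR]
    exact ContinuousOn.aestronglyMeasurable (fun y hy => (continuousAt_integral_mul_besselH hs
      zero_le_one hg hC hgC hy.1).continuousWithinAt) measurableSet_Ioc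
  · rw [Set.uIoc_of_le hR]
    refine (ae_restrict_mem measurableSet_Ioc).mono fun y hy => ?_
    have h1 := intervalIntegral.norm_integral_le_of_norm_le (μ := volume)
      (f := fun t => g t * (t * besselH s (y * t)))
      (g := fun t => C * (D * y ^ (s - 1)) * t ^ (2 * s - 1)) zero_le_one
      (ae_of_all _ fun t ht => abs_mul_scale_le hC ht.1 (hgC t ht) (by
        have ht0 := ht.1
        have hy0 : 0 < y := hy.1
        have e1 : t ^ s = t ^ (s - 1) * t := by rw [← Real.rpow_add_one ht0.ne']; ring_nf
        rw [abs_mul, abs_of_pos ht0, e1]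
        calc t * |besselH s (y * t)| ≤ t * (D * (y * t) ^ (s - 1)) := by
              gcongr
              exact hD _ (by positivity) (by nlinarith [ht.2, hy.2])
          _ = _ := by rw [Real.mul_rpow hy0.le ht0.le]; ring)) (hi.const_mul _)
    rw [intervalIntegral.integral_const_mul] at h1
    refine h1.trans_eq ?_
    ring

end Scale

lemma intervalIntegrable_symplecticBesselScalar (hs : 0 < s) {x R : ℝ} (hx : 0 < x)
    (hR : 0 ≤ R) : IntervalIntegrable
      (fun y => 2 * x * scaleOverlap s x y - besselPhi s x * besselH s y) volume 0 R := by
  obtain ⟨C, hC0, hC⟩ := exists_abs_besselH_comp_le hs 1 hx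
  exact ((intervalIntegrable_integral_mul_besselH hs hR (measurable_besselH_comp hs x) hC0
    hC).const_mul _).sub ((intervalIntegrable_besselH hs 0 R).const_mul _)

/-- The pairing of the scalar kernel, in its second variable, with `besselPhi s` at scale `r`. -/
def kernelPairing (s x R r : ℝ) : ℝ :=
  ∫ y in (0 : ℝ)..R, (2 * x * scaleOverlap s x y - besselPhi s x * besselH s y)
    * besselPhi s (r * y)

lemma integral_scaleOverlap_mul_besselPhi (hs : 0 < s) {x R r : ℝ} (hx : 0 < x) (hR : 0 ≤ R)
    (hr : 0 < r) :
    ∫ y in (0 : ℝ)..R, scaleOverlap s x y * besselPhi s (r * y)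
      = ∫ t in (0 : ℝ)..1, besselH s (x * t) * scalePairing s (t * R) (r / t) := by
  obtain ⟨C, hC0, hC⟩ := exists_abs_besselH_comp_le hs 1 hx
  obtain ⟨D, hD0, hD⟩ := exists_abs_besselH_le hs R
  obtain ⟨E, hE0, hE⟩ := exists_abs_besselPhi_le_const hs
  have g1 : IntegrableOn (fun y : ℝ => y ^ (s - 1)) (Set.uIoc 0 R) :=
    intervalIntegrable_iff.1 (intervalIntegral.intervalIntegrable_rpow' (by linarith))
  have g2 : IntegrableOn (fun t : ℝ => t ^ (2 * s - 1)) (Set.Ioc 0 1) := by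
    rw [← Set.uIoc_of_le zero_le_one]
    exact intervalIntegrable_iff.1 (intervalIntegral.intervalIntegrable_rpow' (by linarith))
  have hint : Integrable (Function.uncurry fun y t =>
      besselH s (x * t) * (t * besselH s (y * t)) * besselPhi s (r * y))
      ((volume.restrict (Set.uIoc 0 R)).prod (volume.restrict (Set.Ioc 0 1))) := by
    refine integrable_prod_restrict_of_abs_le measurableSet_uIoc measurableSet_Ioc ?_
      ((g1.mul_prod g2).const_mul (C * D * E)) ?_
    · exact (((measurable_besselH hs).comp (measurable_const.mul measurable_snd)).mul
        (measurable_snd.mul ((measurable_besselH hs).comp (measurable_fst.mul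
          measurable_snd)))).mul ((continuous_besselPhi hs).measurable.comp
            (measurable_const.mul measurable_fst))
    · intro y hy t ht
      rw [Set.uIoc_of_le hR] at hy
      have ht0 : 0 < t := ht.1
      have hy0 : 0 < y := hy.1
      have h1 := hC t ht
      have h2 := hD (y * t) (by positivity) (by nlinarith [ht.2, hy.2])
      have h3 := hE (r * y) (by positivity)
      have e1 : t ^ (2 * s - 1) = t ^ (s - 1) * (t * t ^ (s - 1)) := by
        rw [mul_comm t, ← Real.rpow_add_one ht0.ne', ← Real.rpow_add ht0]; ring_nf
      rw [abs_mul, abs_mul, abs_mul, abs_of_pos ht0]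
      calc |besselH s (x * t)| * (t * |besselH s (y * t)|) * |besselPhi s (r * y)|
          ≤ C * t ^ (s - 1) * (t * (D * (y * t) ^ (s - 1))) * E := by gcongr
        _ = _ := by
          rw [Real.mul_rpow hy0.le ht0.le, e1]
          ring
  have hswap := intervalIntegral_integral_swap hint
  have hL : ∀ y, ∫ t in Set.Ioc (0 : ℝ) 1,
      besselH s (x * t) * (t * besselH s (y * t)) * besselPhi s (r * y)
        = scaleOverlap s x y * besselPhi s (r * y) := by
    intro y
    rw [integral_mul_const, scaleOverlap, intervalIntegral.integral_of_le zero_le_one]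
  have hRt : ∀ t ∈ Set.Ioc (0 : ℝ) 1, ∫ y in (0 : ℝ)..R,
      besselH s (x * t) * (t * besselH s (y * t)) * besselPhi s (r * y)
        = besselH s (x * t) * scalePairing s (t * R) (r / t) := by
    intro t ht
    have ht0 : 0 < t := ht.1
    have e1 : ∀ y, besselH s (x * t) * (t * besselH s (y * t)) * besselPhi s (r * y)
        = besselH s (x * t) * t * (besselH s (t * y) * besselPhi s (r / t * (t * y))) := by
      intro y
      rw [mul_comm y t, show r / t * (t * y) = r * y by field_simp]
      ring
    simp only [e1]
    rw [intervalIntegral.integral_const_mul, intervalIntegral.integral_comp_mul_left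
      (fun u => besselH s u * besselPhi s (r / t * u)) ht0.ne', mul_zero, smul_eq_mul,
      scalePairing]
    field_simp
  simp only [hL] at hswap
  rw [hswap, setIntegral_congr_fun measurableSet_Ioc hRt,
    intervalIntegral.integral_of_le zero_le_one]

lemma kernelPairing_eq (hs : 0 < s) {x R r : ℝ} (hx : 0 < x) (hR : 0 ≤ R) (hr : 0 < r) :
    kernelPairing s x R r
      = 2 * x * (∫ t in (0 : ℝ)..1, besselH s (x * t) * scalePairing s (t * R) (r / t))
        - besselPhi s x * scalePairing s R r := by
  obtain ⟨C, hC0, hC⟩ := exists_abs_besselH_comp_le hs 1 hx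
  have hφ : ContinuousOn (fun y => besselPhi s (r * y)) (Set.uIcc 0 R) :=
    (continuous_besselPhi_comp hs r).continuousOn
  have i1 : IntervalIntegrable (fun y => scaleOverlap s x y * besselPhi s (r * y)) volume 0 R :=
    (intervalIntegrable_integral_mul_besselH hs hR (measurable_besselH_comp hs x) hC0
      hC).mul_continuousOn hφ
  have i2 : IntervalIntegrable (fun y => besselH s y * besselPhi s (r * y)) volume 0 R :=
    (intervalIntegrable_besselH hs 0 R).mul_continuousOn hφ
  rw [← integral_scaleOverlap_mul_besselPhi hs hx hR hr, scalePairing,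
    ← intervalIntegral.integral_const_mul, ← intervalIntegral.integral_const_mul,
    ← intervalIntegral.integral_sub (i1.const_mul _) (i2.const_mul _), kernelPairing]
  congr 1; ext y; ring

lemma exists_abs_kernelPairing_le (hs : 0 < s) {x : ℝ} (hx : 0 < x) :
    ∃ K, ∀ R, 0 < R → ∀ r, 0 < r → |kernelPairing s x R r| ≤ K := by
  obtain ⟨K, hK0, hK⟩ := exists_abs_scalePairing_le_const hs
  refine ⟨2 * x * ((∫ t in (0 : ℝ)..1, |besselH s (x * t)|) * K) + |besselPhi s x| * K,
    fun R hR r hr => ?_⟩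
  rw [kernelPairing_eq hs hx hR.le hr]
  refine (abs_sub _ _).trans (add_le_add ?_ ?_)
  · rw [abs_mul, abs_of_pos (by positivity : 0 < 2 * x), ← intervalIntegral.integral_mul_const]
    refine mul_le_mul_of_nonneg_left ?_ (by positivity)
    refine intervalIntegral.norm_integral_le_of_norm_le (μ := volume)
      (f := fun t => besselH s (x * t) * scalePairing s (t * R) (r / t))
      zero_le_one (ae_of_all _ fun t ht => ?_)
      ((intervalIntegrable_besselH_comp hs hx 1).abs.mul_const K)
    rw [Real.norm_eq_abs, abs_mul]
    exact mul_le_mul_of_nonneg_left (hK _ (mul_pos ht.1 hR) _ (div_pos hr ht.1)) (abs_nonneg _)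
  · rw [abs_mul]
    exact mul_le_mul_of_nonneg_left (hK R hR r hr) (abs_nonneg _)

/-- Only the scales `t < r` contribute to the limit, each with weight `1/4`. -/
lemma tendsto_integral_besselH_mul_scalePairing (hs : 0 < s) {x r : ℝ} (hx : 0 < x) (hr : 0 < r)
    (hr1 : r ≤ 1) :
    Tendsto (fun R => ∫ t in (0 : ℝ)..1, besselH s (x * t) * scalePairing s (t * R) (r / t))
      atTop (𝓝 (besselPhi s (x * r) / x / 4)) := by
  obtain ⟨K, hK0, hK⟩ := exists_abs_scalePairing_le_const hs
  have hH := intervalIntegrable_besselH_comp hs hx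
  have hlim : ∫ t in (0 : ℝ)..1, besselH s (x * t) * (if t < r then 1 / 4 else 0)
      = besselPhi s (x * r) / x / 4 := by
    have e1 : ∀ t ∈ Set.Ioo 0 r, besselH s (x * t) * (if t < r then 1 / 4 else 0)
        = besselH s (x * t) * (1 / 4) := fun t ht => by rw [if_pos ht.2]
    have e2 : ∀ t ∈ Set.Ioc r 1, besselH s (x * t) * (if t < r then 1 / 4 else 0) = 0 :=
      fun t ht => by rw [if_neg ht.1.le.not_gt, mul_zero]
    have n1 : ∀ᵐ t : ℝ, t ∈ Set.uIoc 0 r →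
        besselH s (x * t) * (1 / 4) = besselH s (x * t) * (if t < r then 1 / 4 else 0) := by
      filter_upwards [compl_mem_ae_iff.2 (measure_singleton r)] with t ht hmem
      rw [Set.uIoc_of_le hr.le] at hmem
      exact (e1 t ⟨hmem.1, lt_of_le_of_ne hmem.2 ht⟩).symm
    have n2 : ∀ᵐ t : ℝ, t ∈ Set.uIoc r 1 →
        0 = besselH s (x * t) * (if t < r then 1 / 4 else 0) := by
      refine ae_of_all _ fun t ht => ?_
      rw [Set.uIoc_of_le hr1] at ht
      exact (e2 t ht).symm
    have i1 : IntervalIntegrable (fun t => besselH s (x * t) * (if t < r then 1 / 4 else 0))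
        volume 0 r :=
      ((hH r).mul_const (1 / 4)).congr_ae ((ae_restrict_iff' measurableSet_uIoc).2 n1)
    have i2 : IntervalIntegrable (fun t => besselH s (x * t) * (if t < r then 1 / 4 else 0))
        volume r 1 :=
      (intervalIntegrable_const (c := (0 : ℝ))).congr_ae
        ((ae_restrict_iff' measurableSet_uIoc).2 n2)
    rw [← intervalIntegral.integral_add_adjacent_intervals i1 i2,
      ← intervalIntegral.integral_congr_ae n1, ← intervalIntegral.integral_congr_ae n2,
      intervalIntegral.integral_zero, add_zero, intervalIntegral.integral_mul_const,
      integral_besselH_comp s hx]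
    ring
  rw [← hlim]
  refine intervalIntegral.tendsto_integral_filter_of_dominated_convergence
    (fun t => |besselH s (x * t)| * K) ?_ ?_ ((hH 1).abs.mul_const K) ?_
  · filter_upwards [eventually_gt_atTop 0] with R hR
    -- On `(0, 1]` the pairing is a combination of functions continuous in the scale.
    have hm : AEStronglyMeasurable (fun t => scalePairing s (t * R) (r / t))
        (volume.restrict (Set.uIoc 0 1)) := by
      have hc : Continuous fun u => scalePairing s (r * R) u :=
        continuous_integral_mul_besselPhi hs (by positivity)
          (intervalIntegrable_besselH hs 0 (r * R))
      have h1 : ∀ t ∈ Set.uIoc (0 : ℝ) 1, scalePairing s (t * R) (r / t)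
          = besselPhi s (t * R) * besselPhi s (r * R) - scalePairing s (r * R) (t / r) := by
        intro t ht
        rw [Set.uIoc_of_le zero_le_one] at ht
        have ht0 : 0 < t := ht.1
        rw [scalePairing_add_inv hs (by positivity) (by positivity), inv_div,
          show r / t * (t * R) = r * R by field_simp]
      have h2 : Continuous fun t =>
          besselPhi s (t * R) * besselPhi s (r * R) - scalePairing s (r * R) (t / r) :=
        (((continuous_besselPhi hs).comp (continuous_id.mul continuous_const)).mul
          continuous_const).sub (hc.comp (continuous_id.div_const r))
      exact h2.aestronglyMeasurable.congr ((ae_restrict_iff' measurableSet_uIoc).2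
        (ae_of_all _ fun t ht => (h1 t ht).symm))
    exact (measurable_besselH_comp hs x).aestronglyMeasurable.mul hm
  · filter_upwards [eventually_gt_atTop 0] with R hR
    refine ae_of_all _ fun t ht => ?_
    rw [Set.uIoc_of_le zero_le_one] at ht
    rw [norm_mul]
    exact mul_le_mul_of_nonneg_left (hK _ (mul_pos ht.1 hR) _ (div_pos hr ht.1)) (norm_nonneg _)
  · filter_upwards [compl_mem_ae_iff.2 (measure_singleton r)] with t htr ht
    rw [Set.uIoc_of_le zero_le_one] at ht
    have htR : Tendsto (fun R : ℝ => t * R) atTop atTop := tendsto_id.const_mul_atTop ht.1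
    refine Tendsto.const_mul _ ?_
    rcases lt_or_gt_of_ne (show t ≠ r from htr) with h | h
    · rw [if_pos h]
      exact (tendsto_scalePairing_of_one_lt hs ((one_lt_div ht.1).2 h)).comp htR
    · rw [if_neg h.not_gt]
      exact (tendsto_scalePairing_of_lt_one hs (div_pos hr ht.1)
        ((div_lt_one ht.1).2 h)).comp htR

lemma tendsto_kernelPairing (hs : 0 < s) {x r L : ℝ} (hx : 0 < x) (hr : 0 < r) (hr1 : r ≤ 1)
    (hL : Tendsto (fun R => scalePairing s R r) atTop (𝓝 L)) :
    Tendsto (fun R => kernelPairing s x R r) atTop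
      (𝓝 (besselPhi s (x * r) / 2 - besselPhi s x * L)) := by
  have h1 := ((tendsto_integral_besselH_mul_scalePairing hs hx hr hr1).const_mul (2 * x)).sub
    (hL.const_mul (besselPhi s x))
  have e1 : 2 * x * (besselPhi s (x * r) / x / 4) = besselPhi s (x * r) / 2 := by
    field_simp; ring
  rw [e1] at h1
  refine h1.congr' ?_
  filter_upwards [eventually_ge_atTop 0] with R hR using (kernelPairing_eq hs hx hR hr).symm

/-- The cut-off integral of the product of the two diagonal entries, through the pairings. -/
lemma integral_symplecticBessel_mul (hs : 0 < s) {x R : ℝ} (hx : 0 < x) (hR : 0 ≤ R) :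
    ∫ y in (0 : ℝ)..R, (2 * x * scaleOverlap s x y - besselPhi s x * besselH s y)
        * (besselH s x * besselPhi s y
          - 2 * ∫ t in (0 : ℝ)..1, besselW s (x * t) * besselPhi s (y * t))
      = besselH s x * kernelPairing s x R 1
        - 2 * ∫ t in (0 : ℝ)..1, besselW s (x * t) * kernelPairing s x R t := by
  set A : ℝ → ℝ := fun y => 2 * x * scaleOverlap s x y - besselPhi s x * besselH s y with hA
  have hAi : IntervalIntegrable A volume 0 R :=
    intervalIntegrable_symplecticBesselScalar hs hx hR
  have hWi := intervalIntegrable_besselW_comp hs hx zero_le_one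
  obtain ⟨E, hE0, hE⟩ := exists_abs_besselPhi_le_const hs
  have hint : Integrable (Function.uncurry fun y t => A y * (besselW s (x * t) *
      besselPhi s (y * t))) ((volume.restrict (Set.uIoc 0 R)).prod
        (volume.restrict (Set.Ioc 0 1))) := by
    have hW' : IntegrableOn (fun t => besselW s (x * t)) (Set.Ioc 0 1) := by
      rw [← Set.uIoc_of_le zero_le_one]
      exact intervalIntegrable_iff.1 hWi
    have hprod := Integrable.mul_prod (intervalIntegrable_iff.1 hAi) hW'
    have e1 : (Function.uncurry fun y t => A y * (besselW s (x * t) * besselPhi s (y * t)))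
        = fun p : ℝ × ℝ => A p.1 * besselW s (x * p.2) * besselPhi s (p.1 * p.2) := by
      ext p; simp only [Function.uncurry]; ring
    rw [e1]
    refine (hprod.norm.mul_const E).mono' (hprod.aestronglyMeasurable.mul
      ((continuous_besselPhi hs).comp (continuous_fst.mul
        continuous_snd)).aestronglyMeasurable) ?_
    rw [Measure.prod_restrict]
    refine (ae_restrict_mem (measurableSet_uIoc.prod measurableSet_Ioc)).mono fun p hp => ?_
    have hp1 := hp.1
    rw [Set.uIoc_of_le hR] at hp1
    rw [norm_mul]
    exact mul_le_mul_of_nonneg_left (hE _ (mul_nonneg hp1.1.le hp.2.1.le)) (norm_nonneg _)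
  have hswap := intervalIntegral_integral_swap hint
  have hRt : ∀ t, ∫ y in (0 : ℝ)..R, A y * (besselW s (x * t) * besselPhi s (y * t))
      = besselW s (x * t) * kernelPairing s x R t := by
    intro t
    rw [kernelPairing, ← intervalIntegral.integral_const_mul]
    congr 1; ext y
    rw [mul_comm y t]; simp only [hA]; ring
  have hLt : ∀ y, ∫ t in Set.Ioc (0 : ℝ) 1, A y * (besselW s (x * t) * besselPhi s (y * t))
      = A y * ∫ t in (0 : ℝ)..1, besselW s (x * t) * besselPhi s (y * t) := by
    intro y
    rw [integral_const_mul, intervalIntegral.integral_of_le zero_le_one]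
  simp only [hRt, hLt] at hswap
  rw [← intervalIntegral.integral_of_le zero_le_one] at hswap
  have i1 : IntervalIntegrable (fun y => A y * besselPhi s (1 * y)) volume 0 R :=
    hAi.mul_continuousOn (continuous_besselPhi_comp hs 1).continuousOn
  have i2 : IntervalIntegrable
      (fun y => A y * ∫ t in (0 : ℝ)..1, besselW s (x * t) * besselPhi s (y * t)) volume 0 R :=
    hAi.mul_continuousOn (continuous_integral_mul_besselPhi hs zero_le_one hWi).continuousOn
  rw [← hswap, kernelPairing, ← intervalIntegral.integral_const_mul,
    ← intervalIntegral.integral_const_mul,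
    ← intervalIntegral.integral_sub (i1.const_mul _) (i2.const_mul _)]
  congr 1; ext y
  simp only [one_mul]; ring

lemma tendsto_integral_symplecticBessel_mul (hs : 0 < s) {x : ℝ} (hx : 0 < x) :
    Tendsto (fun R => ∫ y in (0 : ℝ)..R,
        (2 * x * scaleOverlap s x y - besselPhi s x * besselH s y)
        * (besselH s x * besselPhi s y
          - 2 * ∫ t in (0 : ℝ)..1, besselW s (x * t) * besselPhi s (y * t))) atTop
      (𝓝 (symplecticBesselScalar s x x / 2 - besselH s x * besselPhi s x / 8)) := by
  obtain ⟨K, hK⟩ := exists_abs_kernelPairing_le hs hx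
  have hWi := intervalIntegrable_besselW_comp hs hx zero_le_one
  have h1 := tendsto_kernelPairing hs hx one_pos le_rfl (tendsto_scalePairing_one hs)
  have h2 : Tendsto (fun R => ∫ t in (0 : ℝ)..1, besselW s (x * t) * kernelPairing s x R t) atTop
      (𝓝 (∫ t in (0 : ℝ)..1, besselW s (x * t) * (besselPhi s (x * t) / 2))) := by
    refine intervalIntegral.tendsto_integral_filter_of_dominated_convergence
      (fun t => |besselW s (x * t)| * K) ?_ ?_ (hWi.abs.mul_const K) ?_
    · filter_upwards [eventually_ge_atTop 0] with R hR
      exact (measurable_besselW_comp hs x).aestronglyMeasurable.mul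
        (continuous_integral_mul_besselPhi hs hR
          (intervalIntegrable_symplecticBesselScalar hs hx hR)).aestronglyMeasurable
    · filter_upwards [eventually_gt_atTop 0] with R hR
      refine ae_of_all _ fun t ht => ?_
      rw [Set.uIoc_of_le zero_le_one] at ht
      rw [norm_mul]
      exact mul_le_mul_of_nonneg_left (hK R hR t ht.1) (norm_nonneg _)
    · filter_upwards [compl_mem_ae_iff.2 (measure_singleton (1 : ℝ))] with t ht1 ht
      rw [Set.uIoc_of_le zero_le_one] at ht
      have := tendsto_kernelPairing hs hx ht.1 ht.2
        (tendsto_scalePairing_of_lt_one hs ht.1 (lt_of_le_of_ne ht.2 ht1))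
      rw [mul_zero, sub_zero] at this
      exact this.const_mul _
  have h3 := (h1.const_mul (besselH s x)).sub (h2.const_mul 2)
  have e1 : ∫ t in (0 : ℝ)..1, besselW s (x * t) * (besselPhi s (x * t) / 2)
      = (∫ t in (0 : ℝ)..1, besselW s (x * t) * besselPhi s (x * t)) / 2 := by
    rw [← intervalIntegral.integral_div]
    congr 1; ext t; ring
  have e2 := symplecticBesselScalar_eq_sub hs hx hx
  have e3 : besselH s x * (besselPhi s (x * 1) / 2 - besselPhi s x * (1 / 8))
      - 2 * ∫ t in (0 : ℝ)..1, besselW s (x * t) * (besselPhi s (x * t) / 2)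
      = symplecticBesselScalar s x x / 2 - besselH s x * besselPhi s x / 8 := by
    rw [e1, e2, mul_one]; ring
  rw [e3] at h3
  refine h3.congr' ?_
  filter_upwards [eventually_ge_atTop 0] with R hR using
    (integral_symplecticBessel_mul hs hx hR).symm

/-! ### The integral of the determinant -/

/-- The determinant kernel reproduces the density: the inner integral equals `K(x, x)`. -/
lemma hasImproperIntegral_det (hs : 0 < s) {x : ℝ} (hx : 0 < x) :
    HasImproperIntegral (fun y => (symplecticBesselKernel s x y).det)
      (symplecticBesselScalar s x x) := by
  set A : ℝ → ℝ := fun y => 2 * x * scaleOverlap s x y - besselPhi s x * besselH s y with hA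
  set B : ℝ → ℝ := fun y => besselH s x * besselPhi s y
    - 2 * ∫ t in (0 : ℝ)..1, besselW s (x * t) * besselPhi s (y * t) with hB
  set P := symplecticBesselPrimitive s x with hP
  have hHi := intervalIntegrable_besselH_comp hs hx 1
  have hWi := intervalIntegrable_besselW_comp hs hx zero_le_one
  obtain ⟨C, hC0, hC⟩ := exists_abs_besselW_comp_le hs 1 hx
  have hBc : Continuous B := (continuous_const.mul (continuous_besselPhi hs)).sub
    (continuous_const.mul (continuous_integral_mul_besselPhi hs zero_le_one hWi))
  have hPc : Continuous P := (continuous_const.mul (continuous_besselPhi hs)).sub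
    (continuous_const.mul (continuous_integral_mul_besselPhi hs zero_le_one hHi))
  have hAi : ∀ R, 0 ≤ R → IntervalIntegrable A volume 0 R := fun R hR =>
    intervalIntegrable_symplecticBesselScalar hs hx hR
  have hDi : ∀ R, 0 ≤ R → IntervalIntegrable (fun y => symplecticBesselDeriv s y x) volume 0 R :=
    fun R hR => ((intervalIntegrable_besselH hs 0 R).const_mul (besselH s x)).sub
      ((intervalIntegrable_integral_mul_besselH hs hR (measurable_besselW_comp hs x) hC0
        hC).const_mul 2)
  have hABi : ∀ R, 0 ≤ R → IntervalIntegrable (fun y => A y * B y) volume 0 R := fun R hR =>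
    (hAi R hR).mul_continuousOn hBc.continuousOn
  have hPDi : ∀ R, 0 ≤ R →
      IntervalIntegrable (fun y => P y * symplecticBesselDeriv s y x) volume 0 R := fun R hR =>
    (hDi R hR).continuousOn_mul hPc.continuousOn
  have hdet : ∀ y, 0 < y → A y * B y + P y * symplecticBesselDeriv s y x
      = (symplecticBesselKernel s x y).det := fun y hy =>
    (det_symplecticBesselKernel hs hx hy).symm
  -- The determinant is twice the product of the diagonal entries up to an exact derivative.
  have hval : ∀ R, 0 ≤ R → ∫ y in (0 : ℝ)..R, (symplecticBesselKernel s x y).det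
      = 2 * (∫ y in (0 : ℝ)..R, A y * B y) + P R * B R := by
    intro R hR
    have h1 : ∫ y in (0 : ℝ)..R, (symplecticBesselKernel s x y).det
        = ∫ y in (0 : ℝ)..R, (A y * B y + P y * symplecticBesselDeriv s y x) := by
      refine intervalIntegral.integral_congr_ae (ae_of_all _ fun y hy => ?_)
      rw [Set.uIoc_of_le hR] at hy
      exact (hdet y hy.1).symm
    have h2 := intervalIntegral.integral_eq_sub_of_hasDerivAt_of_le hR
      (f := fun y => P y * B y)
      (f' := fun y => P y * symplecticBesselDeriv s y x - A y * B y)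
      (hPc.mul hBc).continuousOn
      (fun y hy => ((hasDerivAt_symplecticBesselPrimitive hs hx hy.1).mul
        (hasDerivAt_symplecticBesselScalar_expr hs hy.1 hx)).congr_deriv (by
          simp only [hA, hB, hP]; ring))
      ((hPDi R hR).sub (hABi R hR))
    rw [intervalIntegral.integral_sub (hPDi R hR) (hABi R hR)] at h2
    have h3 : P 0 = 0 := by
      simp [hP, symplecticBesselPrimitive, besselPhi_zero]
    rw [h1, intervalIntegral.integral_add (hABi R hR) (hPDi R hR)]
    rw [h3, zero_mul, sub_zero] at h2
    linarith
  refine ⟨fun R hR => ?_, ?_⟩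
  · rw [← Set.uIoc_of_le hR.le, ← intervalIntegrable_iff]
    refine ((hABi R hR.le).add (hPDi R hR.le)).congr_ae
      ((ae_restrict_iff' measurableSet_uIoc).2 (ae_of_all _ fun y hy => ?_))
    rw [Set.uIoc_of_le hR.le] at hy
    exact hdet y hy.1
  · have hPlim : Tendsto P atTop (𝓝 (-(besselPhi s x / 2))) := by
      have h := ((tendsto_besselPhi hs).const_mul (besselPhi s x)).sub
        ((tendsto_integral_mul_besselPhi hs zero_le_one hHi).const_mul (2 * x))
      rw [integral_besselH_comp s hx, mul_one] at h
      have e : besselPhi s x * (1 / 2) - 2 * x * (besselPhi s x / x * (1 / 2))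
          = -(besselPhi s x / 2) := by field_simp; ring
      rwa [e] at h
    have hBlim : Tendsto B atTop (𝓝 (-(besselH s x / 2))) := by
      have h := ((tendsto_besselPhi hs).const_mul (besselH s x)).sub
        ((tendsto_integral_mul_besselPhi hs zero_le_one hWi).const_mul 2)
      rw [integral_besselW_comp hs hx] at h
      have e : besselH s x * (1 / 2) - 2 * (besselH s x * (1 / 2)) = -(besselH s x / 2) := by ring
      rwa [e] at h
    have h := ((tendsto_integral_symplecticBessel_mul hs hx).const_mul 2).add (hPlim.mul hBlim)
    have e : 2 * (symplecticBesselScalar s x x / 2 - besselH s x * besselPhi s x / 8)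
        + -(besselPhi s x / 2) * -(besselH s x / 2) = symplecticBesselScalar s x x := by ring
    rw [e] at h
    refine h.congr' ?_
    filter_upwards [eventually_ge_atTop 0] with R hR using (hval R hR).symm

end

theorem proposition2p10 (s : ℝ) (hs : 0 < s) :
    ∃ I : ℝ → ℝ,
      (∀ x : ℝ, 0 < x →
        HasImproperIntegral (fun y => (symplecticBesselKernel s x y).det) (I x)) ∧
      HasImproperIntegral (fun x => I x - symplecticBesselScalar s x x) 0 := by
  refine ⟨fun x => symplecticBesselScalar s x x, fun x hx => hasImproperIntegral_det hs hx, ?_⟩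
  simp [HasImproperIntegral]
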